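/- Let $(G,H,t,\alpha)$ be a smooth crossed module: Lie groups $G,H$ with Lie algebras $\mathfrak g,\mathfrak h$, a homomorphism $t\colon H\to G$ and a smooth action $\alpha$ of $G$ on $H$ by automorphisms with $t(\alpha_g h)=g\,t(h)\,g^{-1}$ and $\alpha_{t(h)}h'=hh'h^{-1}$. Let $\mathcal G=(G\ltimes H\rightrightarrows G)$ be the corresponding Lie 2-group, where $(g,h)\colon g\to t(h)g$, $(g,h)(g',h')=(gg',h\,\alpha_g(h'))$ and $(t(h)g,h')\circ(g,h)=(g,h'h)$. A $\mathcal G$-2-torsor is a groupoid with a free and transitive right $\mathcal G$-action; $\mathcal G$-2-torsors form a strict 2-category with smooth equivariant functors as 1-morphisms and smooth equivariant natural transformations as 2-morphisms. For a 2-morphism $\eta\colon F\Rightarrow F'$ write $\eta_H(p)=\eta(p):1_{F(p)}\in H$, that is, $1_{F(p)}\cdot\eta_H(p)=\eta(p)$. Let $M$ be a manifold and let $(\mathcal P,A,B)$, $(\mathcal P',A',B')$ be principal $\mathcal G$-2-bundles over $M$ with 2-connection. That is, $\mathcal P_1\rightrightarrows\mathcal P_0$ is a Lie groupoid over $M$ with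 a right $\mathcal G$-action which is principal on objects and on arrows, $A\in\Omega^1(\mathcal P_0,\mathfrak g)$ is a connection, and $B\in\Omega^2(\mathcal P_0,\mathfrak h)$ is horizontal with $R_g^*B=(\alpha_{g}^{-1})_*B$ and $t_*B=F_A$. Let $\mathscr F,\mathscr G\colon\Pi_2^{\rm thin}(M)\to\mathcal G\text{-tor}$ be transport 2-functors (smooth 2-functors on the thin fundamental 2-groupoid of $M$) that correspond to them: up to equivariant identification $\mathscr F(x)$ is the fibre $\mathcal P_x$, for every path $\gamma$ the map $\mathscr F(\gamma)$ is parallel transport $\mathrm{tra}^A_\gamma$ of $A$, and on every bigon $\mathscr F$ is the 2-transport of $(A,B)$; similarly for $\mathscr G$. Let $\rho,\rho'\colon\mathscr F\to\mathscr G$ be pseudonatural transformations that correspond to the 1-morphisms $(F,\phi),(F',\phi')\colon(\mathcal P,A,B)\to(\mathcal P',A',B')$. Here a 1-morphism $(F,\phi)$ is an equivariant smooth functor $F$ over $M$ with a horizontal $\phi\in\Omega^1(\mathcal P_0,\mathfrak h)$ such that $R_g^*\phi=(\alpha_g^{-1})_*\phi$, $F^*A'=A+t_*\phi$ and $F^*B'=B+d\phi+\frac12[\phi\wedge\phi]+\alpha_*(A\wedge\phi)$.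 It corresponds to $\rho$ if $\rho(x)=F|_{\mathcal P_x}$ for all $x\in M$ and if, for every path $\gamma$ in $M$ with initial pieces $\gamma_t(s)=\gamma(st)$ and every horizontal lift $\tilde\gamma$ of $\gamma$, the curve $h(t)=\rho(\gamma_t)_H(\tilde\gamma(0))$ satisfies $h'=-\phi(\tilde\gamma')\,h$. A modification $\rho\Rightarrow\rho'$ is a family of 2-morphisms $\mathcal A(x)\colon\rho(x)\Rightarrow\rho'(x)$, $x\in M$, such that for all $\gamma\colon x\to y$ and all $p\in\mathscr F(x)_0$ $$\mathscr G(\gamma)\big(\mathcal A(x)(p)\big)\circ\rho(\gamma)(p)=\rho'(\gamma)(p)\circ\mathcal A(y)\big(\mathscr F(\gamma)(p)\big).$$ To a family of 2-morphisms $\mathcal A(x)\colon\rho(x)\Rightarrow\rho'(x)$ assign the map $$a\colon\mathcal P_0\to H,\qquad a(p)=\big(\mathcal A(\pi(p))(p):1_{F(p)}\big)^{-1}.$$ Then $\mathcal A$ is a modification if and only if $a$ is a 2-morphism $(F,\phi)\Rightarrow(F',\phi')$ of principal 2-bundles with 2-connection, that is, if and only if $a$ is smooth and satisfies, for all $p\in\mathcal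 P_0$ and $g\in G$, $$a(p\cdot g)=\alpha_{g^{-1}}(a(p)),\qquad F'(p)\cdot t(a(p))=F(p),$$ $$\phi'=\mathrm{Ad}_a\,\phi-(r_{a}^{-1}\circ\alpha_a)_*A-da\,a^{-1},$$ where $(r_{a}^{-1}\circ\alpha_{a})_*\colon\mathfrak g\to\mathfrak h$ at $p$ is the derivative at $1$ of $g\mapsto\alpha(g,a(p))\,a(p)^{-1}$. Moreover $\mathcal A\mapsto a$ is a bijection from the modifications $\rho\Rightarrow\rho'$ onto the maps $a$ with these properties. -/

import Mathlib

open scoped Manifold ContDiff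

noncomputable section

namespace TwoTransport

universe v

/-! ## Smooth crossed modules (Lie 2-groups) -/

section CrossedModule

/-- A smooth crossed module `(G, H, t, α)`.  The corresponding Lie 2-group has objects `G` and
arrows `G ⋉ H`, with source `(g, h) ↦ g`, target `(g, h) ↦ t(h) g`, multiplication
`(g, h)(g', h') = (g g', h α_g(h'))` and composition `(t(h) g, h') ∘ (g, h) = (g, h' h)`. -/
structure SmoothCrossedModule
    (EG : Type*) [NormedAddCommGroup EG] [NormedSpace ℝ EG]
    (G : Type*) [TopologicalSpace G] [ChartedSpace EG G] [Group G]
    (EH : Type*) [NormedAddCommGroup EH] [NormedSpace ℝ EH]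
    (H : Type*) [TopologicalSpace H] [ChartedSpace EH H] [Group H] where
  t : H →* G
  α : G →* MulAut H
  smooth_t : ContMDiff 𝓘(ℝ, EH) 𝓘(ℝ, EG) ∞ t
  smooth_α : ContMDiff (𝓘(ℝ, EG).prod 𝓘(ℝ, EH)) 𝓘(ℝ, EH) ∞ (fun z : G × H => α z.1 z.2)
  t_α : ∀ g h, t (α g h) = g * t h * g⁻¹
  α_t : ∀ h h', α (t h) h' = h * h' * h⁻¹

variable {EG : Type*} [NormedAddCommGroup EG] [NormedSpace ℝ EG]
  {G : Type*} [TopologicalSpace G] [ChartedSpace EG G] [Group G]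
  {EH : Type*} [NormedAddCommGroup EH] [NormedSpace ℝ EH]
  {H : Type*} [TopologicalSpace H] [ChartedSpace EH H] [Group H]

/-! The Lie algebra of `G` is the tangent space at `1`, whose underlying vector space is the model
space `EG`. -/

/-- The Lie bracket of the Lie algebra of `G`. -/
def lieBr (G : Type*) [TopologicalSpace G] [ChartedSpace EG G] [Group G] (ξ η : EG) : EG :=
  Bracket.bracket (L := GroupLieAlgebra 𝓘(ℝ, EG) G) (M := GroupLieAlgebra 𝓘(ℝ, EG) G) ξ η

/-- The adjoint action `Ad_g` on the Lie algebra. -/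
def Ad (g : G) : EG →L[ℝ] EG := mfderiv 𝓘(ℝ, EG) 𝓘(ℝ, EG) (fun x : G => g * x * g⁻¹) 1

/-- The derivative `T_1 G → T_k G` of `x ↦ k x`. -/
def leftTranslate (k : G) : EG →L[ℝ] TangentSpace 𝓘(ℝ, EG) k :=
  mfderiv 𝓘(ℝ, EG) 𝓘(ℝ, EG) (fun x : G => k * x) 1

/-- The derivative `T_1 G → T_k G` of `x ↦ x k`. -/
def rightTranslate (k : G) : EG →L[ℝ] TangentSpace 𝓘(ℝ, EG) k :=
  mfderiv 𝓘(ℝ, EG) 𝓘(ℝ, EG) (fun x : G => x * k) 1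

/-- The derivative `T_k G → T_1 G`, `v ↦ v k⁻¹`, of `x ↦ x k⁻¹`. -/
def rightTrivialize (k : G) : TangentSpace 𝓘(ℝ, EG) k →L[ℝ] EG :=
  mfderiv 𝓘(ℝ, EG) 𝓘(ℝ, EG) (fun x : G => x * k⁻¹) k

namespace SmoothCrossedModule

variable (C : SmoothCrossedModule EG G EH H)

/-- `t_* : 𝔥 → 𝔤`. -/
def tLie : EH →L[ℝ] EG := mfderiv 𝓘(ℝ, EH) 𝓘(ℝ, EG) C.t 1

/-- `(α_g)_* : 𝔥 → 𝔥`. -/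
def αLie (g : G) : EH →L[ℝ] EH := mfderiv 𝓘(ℝ, EH) 𝓘(ℝ, EH) (fun h : H => C.α g h) 1

/-- `α_* : 𝔤 × 𝔥 → 𝔥`, the derivative of `α` in both arguments. -/
def αLie₂ (X : EG) (ξ : EH) : EH :=
  mfderiv 𝓘(ℝ, EG) 𝓘(ℝ, EH) (fun g : G => C.αLie g ξ) 1 X

/-- The derivative `(r_a⁻¹ ∘ α_a)_* : 𝔤 → 𝔥` at `1` of `g ↦ α(g, a) a⁻¹`. -/
def αOrbit (a : H) : EG →L[ℝ] EH :=
  mfderiv 𝓘(ℝ, EG) 𝓘(ℝ, EH) (fun g : G => C.α g a * a⁻¹) 1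

end SmoothCrossedModule

/-! ## Groupoids with an action of a 2-group, and 2-torsors -/

/-- A groupoid `X₁ ⇉ X₀` with a strict right action of the 2-group `G ⋉ H ⇉ G`.
`comp Y X` is `Y ∘ X`; it is meaningful if `tgt X = src Y`.
The element `⟨h, g⟩` of `H ⋊ G` is the arrow `(g, h)` of the 2-group. -/
structure TwoGroupAction (C : SmoothCrossedModule EG G EH H) (X₀ X₁ : Type*) where
  src : X₁ → X₀
  tgt : X₁ → X₀
  one : X₀ → X₁
  comp : X₁ → X₁ → X₁
  inv : X₁ → X₁
  src_one : ∀ p, src (one p) = p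
  tgt_one : ∀ p, tgt (one p) = p
  src_comp : ∀ Y X, tgt X = src Y → src (comp Y X) = src X
  tgt_comp : ∀ Y X, tgt X = src Y → tgt (comp Y X) = tgt Y
  comp_one : ∀ X, comp X (one (src X)) = X
  one_comp : ∀ X, comp (one (tgt X)) X = X
  assoc : ∀ Z Y X, tgt X = src Y → tgt Y = src Z → comp Z (comp Y X) = comp (comp Z Y) X
  src_inv : ∀ X, src (inv X) = tgt X
  tgt_inv : ∀ X, tgt (inv X) = src X
  inv_comp : ∀ X, comp (inv X) X = one (src X)
  comp_inv : ∀ X, comp X (inv X) = one (tgt X)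
  act₀ : X₀ → G → X₀
  act₁ : X₁ → (H ⋊[C.α] G) → X₁
  act₀_one : ∀ p, act₀ p 1 = p
  act₀_mul : ∀ p g g', act₀ (act₀ p g) g' = act₀ p (g * g')
  act₁_one : ∀ X, act₁ X 1 = X
  act₁_mul : ∀ X k k', act₁ (act₁ X k) k' = act₁ X (k * k')
  src_act : ∀ X k, src (act₁ X k) = act₀ (src X) k.right
  tgt_act : ∀ X k, tgt (act₁ X k) = act₀ (tgt X) (C.t k.left * k.right)
  one_act : ∀ p g, one (act₀ p g) = act₁ (one p) ⟨1, g⟩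
  comp_act : ∀ Y X (g : G) (h h' : H), tgt X = src Y →
    comp (act₁ Y ⟨h', C.t h * g⟩) (act₁ X ⟨h, g⟩) = act₁ (comp Y X) ⟨h' * h, g⟩

/-- Functors between groupoids with 2-group action that commute strictly with the actions. -/
@[ext]
structure EquivariantFunctor {C : SmoothCrossedModule EG G EH H} {X₀ X₁ Y₀ Y₁ : Type*}
    (X : TwoGroupAction C X₀ X₁) (Y : TwoGroupAction C Y₀ Y₁) where
  obj : X₀ → Y₀
  arr : X₁ → Y₁
  src_arr : ∀ a, Y.src (arr a) = obj (X.src a)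
  tgt_arr : ∀ a, Y.tgt (arr a) = obj (X.tgt a)
  arr_one : ∀ p, arr (X.one p) = Y.one (obj p)
  arr_comp : ∀ b a, X.tgt a = X.src b → arr (X.comp b a) = Y.comp (arr b) (arr a)
  obj_act : ∀ p g, obj (X.act₀ p g) = Y.act₀ (obj p) g
  arr_act : ∀ a k, arr (X.act₁ a k) = Y.act₁ (arr a) k

/-- Composition `F' ∘ F` of equivariant functors. -/
def EquivariantFunctor.comp {C : SmoothCrossedModule EG G EH H} {X₀ X₁ Y₀ Y₁ Z₀ Z₁ : Type*}
    {X : TwoGroupAction C X₀ X₁} {Y : TwoGroupAction C Y₀ Y₁} {Z : TwoGroupAction C Z₀ Z₁}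
    (F' : EquivariantFunctor Y Z) (F : EquivariantFunctor X Y) : EquivariantFunctor X Z where
  obj p := F'.obj (F.obj p)
  arr a := F'.arr (F.arr a)
  src_arr a := by rw [F'.src_arr, F.src_arr]
  tgt_arr a := by rw [F'.tgt_arr, F.tgt_arr]
  arr_one p := by rw [F.arr_one, F'.arr_one]
  arr_comp b a h := by
    rw [F.arr_comp b a h, F'.arr_comp]
    rw [F.tgt_arr, F.src_arr, h]
  obj_act p g := by rw [F.obj_act, F'.obj_act]
  arr_act a k := by rw [F.arr_act, F'.arr_act]

/-- A 2-torsor of the 2-group: a groupoid with free and transitive action.  Its objects form a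
`G`-torsor and its arrows a `G ⋉ H`-torsor; both carry the smooth structure for which the orbit
maps are diffeomorphisms, and for this structure the groupoid operations, all equivariant functors
and all equivariant natural transformations are smooth automatically. -/
structure TwoTorsor (C : SmoothCrossedModule EG G EH H) where
  Obj : Type v
  Arr : Type v
  toAct : TwoGroupAction C Obj Arr
  nonempty : Nonempty Obj
  free_transitive₀ : ∀ p q, ∃! g : G, toAct.act₀ p g = q
  free_transitive₁ : ∀ X Y, ∃! k : H ⋊[C.α] G, toAct.act₁ X k = Y

namespace TwoTorsor

variable {C : SmoothCrossedModule EG G EH H}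

/-- The division `q : p` in the `G`-torsor of objects: `p · (q : p) = q`. -/
def div₀ (X : TwoTorsor C) (q p : X.Obj) : G := (X.free_transitive₀ p q).choose

/-- The division `Y : X` in the `G ⋉ H`-torsor of arrows: `X · (Y : X) = Y`. -/
def div₁ (X : TwoTorsor C) (b a : X.Arr) : H ⋊[C.α] G := (X.free_transitive₁ a b).choose

/-- For an arrow `a : p → q`, the element `a : 1_p` of `G ⋉ H` lies in `H`. -/
def hPart (X : TwoTorsor C) (a : X.Arr) : H := (X.div₁ a (X.toAct.one (X.toAct.src a))).left

/-- 1-morphisms of 2-torsors. -/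
abbrev Hom (X Y : TwoTorsor C) := EquivariantFunctor X.toAct Y.toAct

/-- 2-morphisms `F ⇒ F'` of 2-torsors: equivariant natural transformations, that is,
`η(p · g) = η(p) · 1_g`. -/
@[ext]
structure TwoHom {X Y : TwoTorsor C} (F F' : Hom X Y) where
  app : X.Obj → Y.Arr
  src_app : ∀ p, Y.toAct.src (app p) = F.obj p
  tgt_app : ∀ p, Y.toAct.tgt (app p) = F'.obj p
  naturality : ∀ a : X.Arr, Y.toAct.comp (app (X.toAct.tgt a)) (F.arr a) =
    Y.toAct.comp (F'.arr a) (app (X.toAct.src a))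
  app_act : ∀ p g, app (X.toAct.act₀ p g) = Y.toAct.act₁ (app p) ⟨1, g⟩

end TwoTorsor

end CrossedModule

/-! ## Paths, bigons and thin homotopies -/

section Paths

variable (EM : Type*) [NormedAddCommGroup EM] [NormedSpace ℝ EM]
  {M : Type*} [TopologicalSpace M] [ChartedSpace EM M]

/-- A smooth path from `x` to `y`.  Only the restriction to `[0, 1]` is relevant up to thin
homotopy; every smooth map `[0, 1] → M` extends to `ℝ`. -/
structure SPath (x y : M) where
  toFun : ℝ → M
  smooth : ContMDiff 𝓘(ℝ, ℝ) 𝓘(ℝ, EM) ∞ toFun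
  source : toFun 0 = x
  target : toFun 1 = y

variable {EM}

/-- The path `γ_t : s ↦ γ(s t)`. -/
def SPath.initial {x y : M} (γ : SPath EM x y) (t : ℝ) : SPath EM x (γ.toFun t) where
  toFun s := γ.toFun (s * t)
  smooth := γ.smooth.comp (contDiff_id.mul contDiff_const).contMDiff
  source := by rw [zero_mul, γ.source]
  target := by rw [one_mul]

/-- A bigon `γ ⇒ γ'` between paths from `x` to `y`: a smooth homotopy `Σ(s, t)` with fixed
endpoints from `Σ(0, ·) = γ` to `Σ(1, ·) = γ'`. -/
structure Bigon {x y : M} (γ γ' : SPath EM x y) where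
  toFun : ℝ × ℝ → M
  smooth : ContMDiff 𝓘(ℝ, ℝ × ℝ) 𝓘(ℝ, EM) ∞ toFun
  start : ∀ s, toFun (s, 0) = x
  finish : ∀ s, toFun (s, 1) = y
  source : ∀ t ∈ Set.Icc (0 : ℝ) 1, toFun (0, t) = γ.toFun t
  target : ∀ t ∈ Set.Icc (0 : ℝ) 1, toFun (1, t) = γ'.toFun t

/-- The path `Σ(s, ·)`. -/
def Bigon.row {x y : M} {γ γ' : SPath EM x y} (S : Bigon γ γ') (s : ℝ) : SPath EM x y where
  toFun t := S.toFun (s, t)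
  smooth := S.smooth.comp (contDiff_const.prodMk contDiff_id).contMDiff
  source := S.start s
  target := S.finish s

/-- The bigon `(u, t) ↦ Σ(u s, t)` from `γ` to `Σ(s, ·)`. -/
def Bigon.initial {x y : M} {γ γ' : SPath EM x y} (S : Bigon γ γ') (s : ℝ) :
    Bigon γ (S.row s) where
  toFun z := S.toFun (z.1 * s, z.2)
  smooth := S.smooth.comp
    ((contDiff_fst.mul contDiff_const).prodMk contDiff_snd).contMDiff
  start u := S.start _
  finish u := S.finish _
  source t ht := by simpa using S.source t ht
  target t _ := by simp [Bigon.row]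

/-- `γ''` is the concatenation "first `γ`, then `γ'`" (which may or may not be smooth for given
`γ`, `γ'`; it is if they are constant near the common endpoint). -/
def IsConcat {x y z : M} (γ : SPath EM x y) (γ' : SPath EM y z) (γ'' : SPath EM x z) : Prop :=
  (∀ t ∈ Set.Icc (0 : ℝ) (1 / 2), γ''.toFun t = γ.toFun (2 * t)) ∧
  (∀ t ∈ Set.Icc (1 / 2 : ℝ) 1, γ''.toFun t = γ'.toFun (2 * t - 1))

/-- `S''` is the vertical concatenation "first `S`, then `S'`". -/
def IsVConcat {x y : M} {γ₀ γ₁ γ₂ : SPath EM x y} (S : Bigon γ₀ γ₁) (S' : Bigon γ₁ γ₂)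
    (S'' : Bigon γ₀ γ₂) : Prop :=
  (∀ s ∈ Set.Icc (0 : ℝ) (1 / 2), ∀ t ∈ Set.Icc (0 : ℝ) 1,
    S''.toFun (s, t) = S.toFun (2 * s, t)) ∧
  (∀ s ∈ Set.Icc (1 / 2 : ℝ) 1, ∀ t ∈ Set.Icc (0 : ℝ) 1,
    S''.toFun (s, t) = S'.toFun (2 * s - 1, t))

/-- `S''` is the horizontal concatenation "first `S`, then `S'`". -/
def IsHConcat {x y z : M} {γ₀ γ₁ : SPath EM x y} {γ₀' γ₁' : SPath EM y z}
    {γ₀'' γ₁'' : SPath EM x z} (S : Bigon γ₀ γ₁) (S' : Bigon γ₀' γ₁') (S'' : Bigon γ₀'' γ₁'') :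
    Prop :=
  (∀ s ∈ Set.Icc (0 : ℝ) 1, ∀ t ∈ Set.Icc (0 : ℝ) (1 / 2),
    S''.toFun (s, t) = S.toFun (s, 2 * t)) ∧
  (∀ s ∈ Set.Icc (0 : ℝ) 1, ∀ t ∈ Set.Icc (1 / 2 : ℝ) 1,
    S''.toFun (s, t) = S'.toFun (s, 2 * t - 1))

/-- The rank at `z` of the differential of `f`. -/
def rankAt {V : Type*} [NormedAddCommGroup V] [NormedSpace ℝ V] (f : V → M) (z : V) : ℕ :=
  Module.finrank ℝ (LinearMap.range (mfderiv 𝓘(ℝ, V) 𝓘(ℝ, EM) f z).toLinearMap)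

/-- Thin homotopy of paths: a smooth homotopy with fixed endpoints of rank at most `1`. -/
def ThinHomotopic {x y : M} (γ γ' : SPath EM x y) : Prop :=
  ∃ S : Bigon γ γ', ∀ s ∈ Set.Icc (0 : ℝ) 1, ∀ t ∈ Set.Icc (0 : ℝ) 1,
    rankAt (EM := EM) S.toFun (s, t) ≤ 1

/-- Thin homotopy of bigons: a smooth homotopy `h(u, s, t)` with fixed endpoints of rank at
most `2`, for which the induced homotopies of the source and target paths are thin. -/
def ThinHomotopic₂ {x y : M} {γ₀ γ₁ γ₀' γ₁' : SPath EM x y} (S : Bigon γ₀ γ₁)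
    (S' : Bigon γ₀' γ₁') : Prop :=
  ∃ h : ℝ × ℝ × ℝ → M, ContMDiff 𝓘(ℝ, ℝ × ℝ × ℝ) 𝓘(ℝ, EM) ∞ h ∧
    (∀ u s, h (u, s, 0) = x) ∧ (∀ u s, h (u, s, 1) = y) ∧
    (∀ s ∈ Set.Icc (0 : ℝ) 1, ∀ t ∈ Set.Icc (0 : ℝ) 1, h (0, s, t) = S.toFun (s, t)) ∧
    (∀ s ∈ Set.Icc (0 : ℝ) 1, ∀ t ∈ Set.Icc (0 : ℝ) 1, h (1, s, t) = S'.toFun (s, t)) ∧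
    (∀ u ∈ Set.Icc (0 : ℝ) 1, ∀ s ∈ Set.Icc (0 : ℝ) 1, ∀ t ∈ Set.Icc (0 : ℝ) 1,
      rankAt (EM := EM) h (u, s, t) ≤ 2) ∧
    (∀ u ∈ Set.Icc (0 : ℝ) 1, ∀ t ∈ Set.Icc (0 : ℝ) 1,
      rankAt (EM := EM) (fun z : ℝ × ℝ => h (z.1, 0, z.2)) (u, t) ≤ 1) ∧
    (∀ u ∈ Set.Icc (0 : ℝ) 1, ∀ t ∈ Set.Icc (0 : ℝ) 1,
      rankAt (EM := EM) (fun z : ℝ × ℝ => h (z.1, 1, z.2)) (u, t) ≤ 1)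

end Paths

/-! ## Transport 2-functors, pseudonatural transformations, modifications -/

section Transport

variable {EG : Type*} [NormedAddCommGroup EG] [NormedSpace ℝ EG]
  {G : Type*} [TopologicalSpace G] [ChartedSpace EG G] [Group G]
  {EH : Type*} [NormedAddCommGroup EH] [NormedSpace ℝ EH]
  {H : Type*} [TopologicalSpace H] [ChartedSpace EH H] [Group H]
  (C : SmoothCrossedModule EG G EH H)
  (EM : Type*) [NormedAddCommGroup EM] [NormedSpace ℝ EM]
  (M : Type*) [TopologicalSpace M] [ChartedSpace EM M]

/-- A transport 2-functor: a smooth strict 2-functor from the thin fundamental 2-groupoid of `M`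
to the 2-category of 2-torsors.  A 2-functor on the quotient by thin homotopy is given on
representatives, by assignments that are invariant under thin homotopy and compatible with
identities and with all concatenations.  The smoothness conditions are tested on smooth families,
parametrized by `ℝⁿ`, of loops and of bigons. -/
structure TransportTwoFunctor where
  obj : M → TwoTorsor.{v} C
  map : ∀ {x y : M}, SPath EM x y → TwoTorsor.Hom (obj x) (obj y)
  map₂ : ∀ {x y : M} {γ γ' : SPath EM x y}, Bigon γ γ' → TwoTorsor.TwoHom (map γ) (map γ')
  map_thin : ∀ {x y : M} (γ γ' : SPath EM x y), ThinHomotopic γ γ' → map γ = map γ'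
  map_obj_id : ∀ {x : M} (γ : SPath EM x x), (∀ t ∈ Set.Icc (0 : ℝ) 1, γ.toFun t = x) →
    ∀ p, (map γ).obj p = p
  map_arr_id : ∀ {x : M} (γ : SPath EM x x), (∀ t ∈ Set.Icc (0 : ℝ) 1, γ.toFun t = x) →
    ∀ a, (map γ).arr a = a
  map_concat : ∀ {x y z : M} (γ : SPath EM x y) (γ' : SPath EM y z) (γ'' : SPath EM x z),
    IsConcat γ γ' γ'' → map γ'' = (map γ').comp (map γ)
  map₂_thin : ∀ {x y : M} {γ₀ γ₁ γ₀' γ₁' : SPath EM x y} (S : Bigon γ₀ γ₁) (S' : Bigon γ₀' γ₁'),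
    ThinHomotopic₂ S S' → ∀ p, (map₂ S).app p = (map₂ S').app p
  map₂_id : ∀ {x y : M} {γ γ' : SPath EM x y} (S : Bigon γ γ'),
    (∀ s ∈ Set.Icc (0 : ℝ) 1, ∀ t ∈ Set.Icc (0 : ℝ) 1, S.toFun (s, t) = γ.toFun t) →
    ∀ p, (map₂ S).app p = (obj y).toAct.one ((map γ).obj p)
  map₂_vconcat : ∀ {x y : M} {γ₀ γ₁ γ₂ : SPath EM x y} (S : Bigon γ₀ γ₁) (S' : Bigon γ₁ γ₂)
    (S'' : Bigon γ₀ γ₂), IsVConcat S S' S'' →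
    ∀ p, (map₂ S'').app p = (obj y).toAct.comp ((map₂ S').app p) ((map₂ S).app p)
  map₂_hconcat : ∀ {x y z : M} {γ₀ γ₁ : SPath EM x y} {γ₀' γ₁' : SPath EM y z}
    {γ₀'' γ₁'' : SPath EM x z} (S : Bigon γ₀ γ₁) (S' : Bigon γ₀' γ₁') (S'' : Bigon γ₀'' γ₁''),
    IsHConcat S S' S'' →
    ∀ p, (map₂ S'').app p =
      (obj z).toAct.comp ((map₂ S').app ((map γ₁).obj p)) ((map γ₀').arr ((map₂ S).app p))
  smooth_loops : ∀ (x : M) (n : ℕ) (c : EuclideanSpace ℝ (Fin n) → SPath EM x x),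
    ContMDiff 𝓘(ℝ, EuclideanSpace ℝ (Fin n) × ℝ) 𝓘(ℝ, EM) ∞
      (fun z : EuclideanSpace ℝ (Fin n) × ℝ => (c z.1).toFun z.2) →
    ∀ p, ContMDiff 𝓘(ℝ, EuclideanSpace ℝ (Fin n)) 𝓘(ℝ, EG) ∞
      (fun u => (obj x).div₀ ((map (c u)).obj p) p)
  smooth_bigons : ∀ (x y : M) (n : ℕ) (γ γ' : EuclideanSpace ℝ (Fin n) → SPath EM x y)
    (S : ∀ u, Bigon (γ u) (γ' u)),
    ContMDiff 𝓘(ℝ, EuclideanSpace ℝ (Fin n) × ℝ × ℝ) 𝓘(ℝ, EM) ∞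
      (fun z : EuclideanSpace ℝ (Fin n) × ℝ × ℝ => (S z.1).toFun z.2) →
    ∀ p, ContMDiff 𝓘(ℝ, EuclideanSpace ℝ (Fin n)) 𝓘(ℝ, EH) ∞
      (fun u => (obj y).hPart ((map₂ (S u)).app p))

variable {C EM M}

/-- A pseudonatural transformation `ρ : 𝓕 → 𝓖`: 1-morphisms `ρ(x) : 𝓕(x) → 𝓖(x)` and 2-morphisms
`ρ(γ) : ρ(y) ∘ 𝓕(γ) ⇒ 𝓖(γ) ∘ ρ(x)`, depending only on the thin homotopy class of `γ`,
preserving composition of paths and compatible with bigons. -/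
structure PseudoNat (𝓕 𝓖 : TransportTwoFunctor C EM M) where
  app : ∀ x, TwoTorsor.Hom (𝓕.obj x) (𝓖.obj x)
  cell : ∀ {x y : M} (γ : SPath EM x y),
    TwoTorsor.TwoHom ((app y).comp (𝓕.map γ)) ((𝓖.map γ).comp (app x))
  cell_thin : ∀ {x y : M} (γ γ' : SPath EM x y), ThinHomotopic γ γ' →
    ∀ p, (cell γ).app p = (cell γ').app p
  cell_concat : ∀ {x y z : M} (γ : SPath EM x y) (γ' : SPath EM y z) (γ'' : SPath EM x z),
    IsConcat γ γ' γ'' → ∀ p, (cell γ'').app p =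
      (𝓖.obj z).toAct.comp ((𝓖.map γ').arr ((cell γ).app p)) ((cell γ').app ((𝓕.map γ).obj p))
  cell_bigon : ∀ {x y : M} {γ γ' : SPath EM x y} (S : Bigon γ γ') (p),
    (𝓖.obj y).toAct.comp ((𝓖.map₂ S).app ((app x).obj p)) ((cell γ).app p) =
      (𝓖.obj y).toAct.comp ((cell γ').app p) ((app y).arr ((𝓕.map₂ S).app p))

/-- A family of 2-morphisms `𝓐(x) : ρ(x) ⇒ ρ'(x)` is a modification if for every `γ : x → y`
`(𝓖(γ) 𝓐(x)) • ρ(γ) = ρ'(γ) • (𝓐(y) 𝓕(γ))`. -/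
def IsModification {𝓕 𝓖 : TransportTwoFunctor C EM M} (ρ ρ' : PseudoNat 𝓕 𝓖)
    (𝓐 : ∀ x, TwoTorsor.TwoHom (ρ.app x) (ρ'.app x)) : Prop :=
  ∀ {x y : M} (γ : SPath EM x y) (p : (𝓕.obj x).Obj),
    (𝓖.obj y).toAct.comp ((𝓖.map γ).arr ((𝓐 x).app p)) ((ρ.cell γ).app p) =
      (𝓖.obj y).toAct.comp ((ρ'.cell γ).app p) ((𝓐 y).app ((𝓕.map γ).obj p))

end Transport

/-! ## Vector-valued differential forms -/

section Forms

variable {E : Type*} [NormedAddCommGroup E] [NormedSpace ℝ E]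
  {P : Type*} [TopologicalSpace P] [ChartedSpace E P]
  {V : Type*} [NormedAddCommGroup V] [NormedSpace ℝ V]

/-- The derivative at `y` of the inverse of the chart around `p`. -/
def chartInvDeriv (p : P) (y : E) :
    E →L[ℝ] TangentSpace 𝓘(ℝ, E) ((extChartAt 𝓘(ℝ, E) p).symm y) :=
  mfderiv 𝓘(ℝ, E) 𝓘(ℝ, E) (extChartAt 𝓘(ℝ, E) p).symm y

/-- The expression of a 1-form in the chart around `p`. -/
def localOneForm (θ : ∀ p : P, TangentSpace 𝓘(ℝ, E) p →L[ℝ] V) (p : P) (y : E) : E →L[ℝ] V :=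
  (θ ((extChartAt 𝓘(ℝ, E) p).symm y)).comp (chartInvDeriv p y)

/-- Smoothness of a 1-form. -/
def SmoothOneForm (θ : ∀ p : P, TangentSpace 𝓘(ℝ, E) p →L[ℝ] V) : Prop :=
  ∀ p, ContDiffOn ℝ ∞ (localOneForm θ p) (extChartAt 𝓘(ℝ, E) p).target

/-- Smoothness of a bilinear form: its coefficients in every chart are smooth. -/
def SmoothTwoForm
    (θ : ∀ p : P, TangentSpace 𝓘(ℝ, E) p →L[ℝ] TangentSpace 𝓘(ℝ, E) p →L[ℝ] V) : Prop :=
  ∀ (p : P) (v w : E), ContDiffOn ℝ ∞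
    (fun y => θ ((extChartAt 𝓘(ℝ, E) p).symm y) (chartInvDeriv p y v) (chartInvDeriv p y w))
    (extChartAt 𝓘(ℝ, E) p).target

/-- The exterior derivative `dθ(v, w) = ∂_v (θ(w)) - ∂_w (θ(v))` of a 1-form, computed in the
chart around `p`. -/
def extDerivOne (θ : ∀ p : P, TangentSpace 𝓘(ℝ, E) p →L[ℝ] V) (p : P)
    (v w : TangentSpace 𝓘(ℝ, E) p) : V :=
  let D : TangentSpace 𝓘(ℝ, E) p →L[ℝ] E :=
    mfderiv 𝓘(ℝ, E) 𝓘(ℝ, E) (extChartAt 𝓘(ℝ, E) p) p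
  fderiv ℝ (localOneForm θ p) (extChartAt 𝓘(ℝ, E) p p) (D v) (D w) -
    fderiv ℝ (localOneForm θ p) (extChartAt 𝓘(ℝ, E) p p) (D w) (D v)

/-- The velocity at time `t` of a curve. -/
def velocity (c : ℝ → P) (t : ℝ) : TangentSpace 𝓘(ℝ, E) (c t) :=
  mfderiv 𝓘(ℝ, ℝ) 𝓘(ℝ, E) c t (1 : ℝ)

/-- The curve `c` is differentiable at time `t`, with velocity `v`. -/
def HasVelocityAt (c : ℝ → P) (t : ℝ) (v : TangentSpace 𝓘(ℝ, E) (c t)) : Prop :=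
  HasMFDerivAt 𝓘(ℝ, ℝ) 𝓘(ℝ, E) c t (ContinuousLinearMap.toSpanSingleton ℝ v)

end Forms

/-! ## Principal 2-bundles with 2-connection -/

section Bundles

variable {EG : Type*} [NormedAddCommGroup EG] [NormedSpace ℝ EG]
  {G : Type*} [TopologicalSpace G] [ChartedSpace EG G] [Group G]
  {EH : Type*} [NormedAddCommGroup EH] [NormedSpace ℝ EH]
  {H : Type*} [TopologicalSpace H] [ChartedSpace EH H] [Group H]
  (C : SmoothCrossedModule EG G EH H)
  (EM : Type*) [NormedAddCommGroup EM] [NormedSpace ℝ EM]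
  (M : Type*) [TopologicalSpace M] [ChartedSpace EM M]
  (P₀ : Type*) [TopologicalSpace P₀] [ChartedSpace (EM × EG) P₀]
  (P₁ : Type*) [TopologicalSpace P₁] [ChartedSpace (EM × EG × EH) P₁]

/-- A principal 2-bundle over `M`: a Lie groupoid `P₁ ⇉ P₀` with a smooth right action of the
2-group and an invariant surjective submersion functor to `M ⇉ M`, such that
`(p, g) ↦ (p, p · g)` is an isomorphism onto the fibre product, that is, has a smooth inverse,
given by division.  (The dimensions of `P₀` and `P₁` are forced, so we may take `EM × EG` and
`EM × EG × EH` as model spaces.) -/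
structure PrincipalTwoBundle extends TwoGroupAction C P₀ P₁ where
  smooth_src : ContMDiff 𝓘(ℝ, EM × EG × EH) 𝓘(ℝ, EM × EG) ∞ src
  smooth_tgt : ContMDiff 𝓘(ℝ, EM × EG × EH) 𝓘(ℝ, EM × EG) ∞ tgt
  submersion_src : ∀ X, Function.Surjective
    (mfderiv 𝓘(ℝ, EM × EG × EH) 𝓘(ℝ, EM × EG) src X)
  submersion_tgt : ∀ X, Function.Surjective
    (mfderiv 𝓘(ℝ, EM × EG × EH) 𝓘(ℝ, EM × EG) tgt X)
  smooth_one : ContMDiff 𝓘(ℝ, EM × EG) 𝓘(ℝ, EM × EG × EH) ∞ one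
  smooth_inv : ContMDiff 𝓘(ℝ, EM × EG × EH) 𝓘(ℝ, EM × EG × EH) ∞ inv
  smooth_comp : ContMDiffOn (𝓘(ℝ, EM × EG × EH).prod 𝓘(ℝ, EM × EG × EH))
    𝓘(ℝ, EM × EG × EH) ∞ (fun z : P₁ × P₁ => comp z.1 z.2) {z | tgt z.2 = src z.1}
  smooth_act₀ : ContMDiff (𝓘(ℝ, EM × EG).prod 𝓘(ℝ, EG)) 𝓘(ℝ, EM × EG) ∞
    (fun z : P₀ × G => act₀ z.1 z.2)
  smooth_act₁ : ContMDiff (𝓘(ℝ, EM × EG × EH).prod (𝓘(ℝ, EG).prod 𝓘(ℝ, EH)))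
    𝓘(ℝ, EM × EG × EH) ∞ (fun z : P₁ × (G × H) => act₁ z.1 ⟨z.2.2, z.2.1⟩)
  π₀ : P₀ → M
  π₁ : P₁ → M
  smooth_π₀ : ContMDiff 𝓘(ℝ, EM × EG) 𝓘(ℝ, EM) ∞ π₀
  smooth_π₁ : ContMDiff 𝓘(ℝ, EM × EG × EH) 𝓘(ℝ, EM) ∞ π₁
  surjective_π₀ : Function.Surjective π₀
  surjective_π₁ : Function.Surjective π₁
  submersion_π₀ : ∀ p, Function.Surjective (mfderiv 𝓘(ℝ, EM × EG) 𝓘(ℝ, EM) π₀ p)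
  submersion_π₁ : ∀ X, Function.Surjective (mfderiv 𝓘(ℝ, EM × EG × EH) 𝓘(ℝ, EM) π₁ X)
  π₀_src : ∀ X, π₀ (src X) = π₁ X
  π₀_tgt : ∀ X, π₀ (tgt X) = π₁ X
  π₀_act : ∀ p g, π₀ (act₀ p g) = π₀ p
  π₁_act : ∀ X k, π₁ (act₁ X k) = π₁ X
  div₀ : P₀ → P₀ → G
  div₁ : P₁ → P₁ → H ⋊[C.α] G
  act_div₀ : ∀ q p, π₀ q = π₀ p → act₀ p (div₀ q p) = q
  div_act₀ : ∀ p g, div₀ (act₀ p g) p = g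
  act_div₁ : ∀ Y X, π₁ Y = π₁ X → act₁ X (div₁ Y X) = Y
  div_act₁ : ∀ X k, div₁ (act₁ X k) X = k
  smooth_div₀ : ContMDiffOn (𝓘(ℝ, EM × EG).prod 𝓘(ℝ, EM × EG)) 𝓘(ℝ, EG) ∞
    (fun z : P₀ × P₀ => div₀ z.1 z.2) {z | π₀ z.1 = π₀ z.2}
  smooth_div₁ : ContMDiffOn (𝓘(ℝ, EM × EG × EH).prod 𝓘(ℝ, EM × EG × EH))
    (𝓘(ℝ, EG).prod 𝓘(ℝ, EH)) ∞
    (fun z : P₁ × P₁ => ((div₁ z.1 z.2).right, (div₁ z.1 z.2).left)) {z | π₁ z.1 = π₁ z.2}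

variable {C EM M P₀ P₁}

/-- The fundamental vector field `X_ξ` at `p`. -/
def PrincipalTwoBundle.fundamental (P : PrincipalTwoBundle C EM M P₀ P₁) (p : P₀) (ξ : EG) :
    TangentSpace 𝓘(ℝ, EM × EG) p :=
  mfderiv 𝓘(ℝ, EG) 𝓘(ℝ, EM × EG) (fun g : G => P.act₀ p g) 1 ξ

/-- The derivative `T_p P₀ → T_{p g} P₀` of the right translation `R_g`. -/
def PrincipalTwoBundle.dR (P : PrincipalTwoBundle C EM M P₀ P₁) (g : G) (p : P₀) :
    TangentSpace 𝓘(ℝ, EM × EG) p →L[ℝ] TangentSpace 𝓘(ℝ, EM × EG) (P.act₀ p g) :=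
  mfderiv 𝓘(ℝ, EM × EG) 𝓘(ℝ, EM × EG) (fun q => P.act₀ q g) p

/-- A 2-connection `(A, B)`. -/
structure TwoConnection (P : PrincipalTwoBundle C EM M P₀ P₁) where
  A : ∀ p : P₀, TangentSpace 𝓘(ℝ, EM × EG) p →L[ℝ] EG
  B : ∀ p : P₀, TangentSpace 𝓘(ℝ, EM × EG) p →L[ℝ] TangentSpace 𝓘(ℝ, EM × EG) p →L[ℝ] EH
  smooth_A : SmoothOneForm A
  A_fundamental : ∀ p ξ, A p (P.fundamental p ξ) = ξ
  A_equivariant : ∀ g p v, A (P.act₀ p g) (P.dR g p v) = Ad g⁻¹ (A p v)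
  smooth_B : SmoothTwoForm B
  B_alternating : ∀ p v, B p v v = 0
  B_equivariant : ∀ g p v w,
    B (P.act₀ p g) (P.dR g p v) (P.dR g p w) = C.αLie g⁻¹ (B p v w)
  B_horizontal : ∀ p ξ v, B p (P.fundamental p ξ) v = 0
  /-- `t_* B = F_A = dA + ½ [A ∧ A]`. -/
  fake_flat : ∀ p v w, C.tLie (B p v w) = extDerivOne A p v w + lieBr G (A p v) (A p w)

variable {P₀' : Type*} [TopologicalSpace P₀'] [ChartedSpace (EM × EG) P₀']
  {P₁' : Type*} [TopologicalSpace P₁'] [ChartedSpace (EM × EG × EH) P₁']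
  {P : PrincipalTwoBundle C EM M P₀ P₁} {P' : PrincipalTwoBundle C EM M P₀' P₁'}

/-- A 1-morphism `(F, φ)` of principal 2-bundles with 2-connection. -/
structure BundleHom (D : TwoConnection P) (D' : TwoConnection P') where
  F : EquivariantFunctor P.toTwoGroupAction P'.toTwoGroupAction
  φ : ∀ p : P₀, TangentSpace 𝓘(ℝ, EM × EG) p →L[ℝ] EH
  smooth_obj : ContMDiff 𝓘(ℝ, EM × EG) 𝓘(ℝ, EM × EG) ∞ F.obj
  smooth_arr : ContMDiff 𝓘(ℝ, EM × EG × EH) 𝓘(ℝ, EM × EG × EH) ∞ F.arr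
  π_obj : ∀ p, P'.π₀ (F.obj p) = P.π₀ p
  π_arr : ∀ X, P'.π₁ (F.arr X) = P.π₁ X
  smooth_φ : SmoothOneForm φ
  φ_equivariant : ∀ g p v, φ (P.act₀ p g) (P.dR g p v) = C.αLie g⁻¹ (φ p v)
  φ_horizontal : ∀ p ξ, φ p (P.fundamental p ξ) = 0
  /-- `F^* A' = A + t_* φ`. -/
  pullback_A : ∀ p v,
    D'.A (F.obj p) (mfderiv 𝓘(ℝ, EM × EG) 𝓘(ℝ, EM × EG) F.obj p v) =
      D.A p v + C.tLie (φ p v)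
  /-- `F^* B' = B + dφ + ½ [φ ∧ φ] + α_* (A ∧ φ)`. -/
  pullback_B : ∀ p v w,
    D'.B (F.obj p) (mfderiv 𝓘(ℝ, EM × EG) 𝓘(ℝ, EM × EG) F.obj p v)
        (mfderiv 𝓘(ℝ, EM × EG) 𝓘(ℝ, EM × EG) F.obj p w) =
      D.B p v w + extDerivOne φ p v w + lieBr H (φ p v) (φ p w) +
        (C.αLie₂ (D.A p v) (φ p w) - C.αLie₂ (D.A p w) (φ p v))

/-- A 2-morphism `a : (F, φ) ⇒ (F', φ')` of principal 2-bundles with 2-connection. -/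
structure IsBundleTwoHom {D : TwoConnection P} {D' : TwoConnection P'} (f f' : BundleHom D D')
    (a : P₀ → H) : Prop where
  smooth : ContMDiff 𝓘(ℝ, EM × EG) 𝓘(ℝ, EH) ∞ a
  equivariant : ∀ p g, a (P.act₀ p g) = C.α g⁻¹ (a p)
  obj_eq : ∀ p, P'.act₀ (f'.F.obj p) (C.t (a p)) = f.F.obj p
  /-- `φ' = Ad_a φ - (r_a⁻¹ ∘ α_a)_* A - da a⁻¹`. -/
  φ_eq : ∀ p v, f'.φ p v =
    Ad (a p) (f.φ p v) - C.αOrbit (a p) (D.A p v) -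
      rightTrivialize (a p) (mfderiv 𝓘(ℝ, EM × EG) 𝓘(ℝ, EH) a p v)

/-! ## The correspondence between transport data and bundle data -/

/-- The transport 2-functor `𝓕` corresponds to the 2-bundle with 2-connection `(P, A, B)`:
there are equivariant identifications of the fibres of `P₀` with the torsors `𝓕(x)₀` (they extend
uniquely to the arrows), under which `𝓕(γ)` is parallel transport of `A` along `γ` and `𝓕(S)` is
the parallel 2-transport of `(A, B)` along the bigon `S`. -/
structure Realization (𝓕 : TransportTwoFunctor C EM M) (D : TwoConnection P) where
  e : ∀ x : M, {p : P₀ // P.π₀ p = x} ≃ (𝓕.obj x).Obj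
  e_act : ∀ (x : M) (p : P₀) (hp : P.π₀ p = x) (g : G),
    e x ⟨P.act₀ p g, (P.π₀_act p g).trans hp⟩ = (𝓕.obj x).toAct.act₀ (e x ⟨p, hp⟩) g
  /-- For every path `γ` and every `p` over its starting point, `t ↦ 𝓕(γ_t)(p)` is the horizontal
  lift of `γ` that starts at `p`. -/
  horizontal : ∀ {x y : M} (γ : SPath EM x y) (p : {p : P₀ // P.π₀ p = x}),
    let c : ℝ → P₀ := fun t => ((e (γ.toFun t)).symm ((𝓕.map (γ.initial t)).obj (e x p))).1
    ContMDiff 𝓘(ℝ, ℝ) 𝓘(ℝ, EM × EG) ∞ c ∧ c 0 = p.1 ∧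
      ∀ t, D.A (c t) (velocity (E := EM × EG) c t) = 0
  /-- For a bigon `S` and `p` over its starting point let `S̃(s, ·)` be the horizontal lift of
  `S(s, ·)` that starts at `p`, and let `η(s)` be the `H`-component at `p` of the 2-transport along
  the part of `S` between the parameters `0` and `s`.  Then `η` is the path-ordered exponential
  given by `η' = η · ∫₀¹ B(∂_t S̃, ∂_s S̃) dt`. -/
  surface : ∀ {x y : M} {γ γ' : SPath EM x y} (S : Bigon γ γ') (p : {p : P₀ // P.π₀ p = x}),
    let L : ℝ → ℝ → P₀ := fun s t =>
      ((e (S.toFun (s, t))).symm ((𝓕.map ((S.row s).initial t)).obj (e x p))).1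
    let η : ℝ → H := fun s => (𝓕.obj y).hPart ((𝓕.map₂ (S.initial s)).app (e x p))
    ∀ s, HasVelocityAt (E := EH) η s (leftTranslate (η s)
      (∫ t in (0 : ℝ)..1, D.B (L s t) (velocity (E := EM × EG) (fun τ => L s τ) t)
        (velocity (E := EM × EG) (fun σ => L σ t) s)))

variable {𝓕 𝓖 : TransportTwoFunctor C EM M} {D : TwoConnection P} {D' : TwoConnection P'}

/-- The pseudonatural transformation `ρ` corresponds to the 1-morphism `(F, φ)`: `ρ(x)` is the
restriction of `F` to the fibres over `x`, and `φ` is minus the derivative of the `H`-component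
`ρ_H(γ_t)(p)` of `ρ`.  That is, along the horizontal lift `c` of `γ` starting at `p`, the curve
`h(t) = ρ_H(γ_t)(p)` satisfies `h' = - φ(c') h`; equivalently it is the path-ordered exponential
of `- φ(c')`. -/
structure PseudoNat.Corresponds (r : Realization 𝓕 D) (r' : Realization 𝓖 D')
    (ρ : PseudoNat 𝓕 𝓖) (f : BundleHom D D') : Prop where
  obj_eq : ∀ (x : M) (p : P₀) (hp : P.π₀ p = x),
    (ρ.app x).obj (r.e x ⟨p, hp⟩) = r'.e x ⟨f.F.obj p, (f.π_obj p).trans hp⟩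
  cell_eq : ∀ {x y : M} (γ : SPath EM x y) (p : {p : P₀ // P.π₀ p = x}),
    let c : ℝ → P₀ := fun t =>
      ((r.e (γ.toFun t)).symm ((𝓕.map (γ.initial t)).obj (r.e x p))).1
    let h : ℝ → H := fun t =>
      (𝓖.obj (γ.toFun t)).hPart ((ρ.cell (γ.initial t)).app (r.e x p))
    ∀ t, HasVelocityAt (E := EH) h t
      (rightTranslate (h t) (-(f.φ (c t) (velocity (E := EM × EG) c t))))

/-- The map `P₀ → H`, `p ↦ 𝓐(π(p))(p) : 1_{ρ(p)}`, given by a family of 2-morphisms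
`𝓐(x) : ρ(x) ⇒ ρ'(x)`. -/
def hMap (r : Realization 𝓕 D) {ρ ρ' : PseudoNat 𝓕 𝓖}
    (𝓐 : ∀ x, TwoTorsor.TwoHom (ρ.app x) (ρ'.app x)) (p : P₀) : H :=
  (𝓖.obj (P.π₀ p)).hPart ((𝓐 (P.π₀ p)).app (r.e (P.π₀ p) ⟨p, rfl⟩))

end Bundles

end TwoTransport

end

open TwoTransport

/-! An arrow of a 2-torsor is determined by its source and its `H`-component, and `H`-components
multiply in reverse order under composition. The modification equation is therefore an identity in
`H` for each path. Applied to the initial pieces of γ, with horizontal lift c, it reads a(c(t)) =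
k'(t) a(c(0)) k(t)⁻¹. Here k, k' are the `H`-components of ρ, ρ' along the pieces γ_t; they start at
1 and have right logarithmic derivatives -φ(c') and -φ'(c').

If a is a 2-morphism of bundles, the equation for φ' together with A(c') = 0 shows that k'⁻¹ a(c) k
has velocity zero. It is then constant, and this constancy is the modification equation
(`IsBundleTwoHom.isModification`).

Conversely, any smooth curve K in `P₀` is c · g for a horizontal lift c and a smooth curve g in `G`.
Equivariance of a then expresses a(K(t)) through curves that pass through 1 with velocities -A(K'),
-φ'(K') and φ(K') (`IsModification.exists_curves`). Differentiating gives the equation for φ',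
provided that a is smooth. A modification is not assumed to depend smoothly, or even continuously,
on the point, so smoothness has to be proved. In charts, a solves a total differential equation da =
Θ(·, a) with smooth Θ along curves. An a priori bound gives continuity, continuity gives
differentiability with derivative Θ(·, a), and bootstrapping gives all derivatives
(`SolvesAlongCurves.contDiffAt`).

For the bijection, a family of 2-morphisms is the same as its `H`-components, because naturality
follows from equivariance and the Peiffer identity (`TwoTorsor.TwoHom.ofHPart`). -/

namespace TwoTransport

/-! ### Arrows and 2-morphisms of 2-torsors in terms of `H`-components -/

section Torsors

variable {EG : Type*} [NormedAddCommGroup EG] [NormedSpace ℝ EG]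
  {G : Type*} [TopologicalSpace G] [ChartedSpace EG G] [Group G]
  {EH : Type*} [NormedAddCommGroup EH] [NormedSpace ℝ EH]
  {H : Type*} [TopologicalSpace H] [ChartedSpace EH H] [Group H]
  {C : SmoothCrossedModule EG G EH H}

namespace TwoTorsor

theorem act₁_left_cancel (X : TwoTorsor C) {a : X.Arr} {k k' : H ⋊[C.α] G}
    (h : X.toAct.act₁ a k = X.toAct.act₁ a k') : k = k' :=
  (X.free_transitive₁ a (X.toAct.act₁ a k')).unique h rfl

theorem act₀_left_cancel (X : TwoTorsor C) {p : X.Obj} {g g' : G}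
    (h : X.toAct.act₀ p g = X.toAct.act₀ p g') : g = g' :=
  (X.free_transitive₀ p (X.toAct.act₀ p g')).unique h rfl

/-- The arrow with source `p` and `H`-component `h`. -/
def mkArr (X : TwoTorsor C) (p : X.Obj) (h : H) : X.Arr :=
  X.toAct.act₁ (X.toAct.one p) ⟨h, 1⟩

variable {X Y : TwoTorsor C}

theorem src_mkArr (p : X.Obj) (h : H) : X.toAct.src (X.mkArr p h) = p := by
  rw [mkArr, X.toAct.src_act, X.toAct.src_one, X.toAct.act₀_one]

theorem tgt_mkArr (p : X.Obj) (h : H) :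
    X.toAct.tgt (X.mkArr p h) = X.toAct.act₀ p (C.t h) := by
  rw [mkArr, X.toAct.tgt_act, X.toAct.tgt_one, mul_one]

theorem mkArr_src_hPart (a : X.Arr) : X.mkArr (X.toAct.src a) (X.hPart a) = a := by
  have h := (X.free_transitive₁ (X.toAct.one (X.toAct.src a)) a).choose_spec.1
  have hs := congrArg X.toAct.src h
  simp only [X.toAct.src_act, X.toAct.src_one] at hs
  have hr : (X.div₁ a (X.toAct.one (X.toAct.src a))).right = 1 := by
    apply X.act₀_left_cancel (p := X.toAct.src a)
    rw [X.toAct.act₀_one]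
    exact hs
  have : (⟨X.hPart a, 1⟩ : H ⋊[C.α] G) = X.div₁ a (X.toAct.one (X.toAct.src a)) := by
    ext
    · rfl
    · exact hr.symm
  rw [mkArr, this]
  exact h

theorem hPart_mkArr (p : X.Obj) (h : H) : X.hPart (X.mkArr p h) = h := by
  have := mkArr_src_hPart (X.mkArr p h)
  rw [src_mkArr] at this
  exact congrArg SemidirectProduct.left (X.act₁_left_cancel this)

theorem arr_ext {a b : X.Arr} (hs : X.toAct.src a = X.toAct.src b)
    (hh : X.hPart a = X.hPart b) : a = b := by
  rw [← mkArr_src_hPart a, ← mkArr_src_hPart b, hs, hh]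

theorem tgt_eq_act (a : X.Arr) :
    X.toAct.tgt a = X.toAct.act₀ (X.toAct.src a) (C.t (X.hPart a)) := by
  conv_lhs => rw [← mkArr_src_hPart a, tgt_mkArr]

theorem mkArr_act (p : X.Obj) (h : H) (g : G) :
    X.toAct.act₁ (X.mkArr p h) ⟨1, g⟩ = X.mkArr (X.toAct.act₀ p g) (C.α g⁻¹ h) := by
  rw [mkArr, mkArr, X.toAct.one_act, X.toAct.act₁_mul, X.toAct.act₁_mul]
  congr 1
  ext
  · simp
  · simp

theorem hPart_act (a : X.Arr) (g : G) :
    X.hPart (X.toAct.act₁ a ⟨1, g⟩) = C.α g⁻¹ (X.hPart a) := by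
  conv_lhs => rw [← mkArr_src_hPart a, mkArr_act, hPart_mkArr]

/-- By the Peiffer identity the second arrow is 1_p acted on by (t(h), h h' h⁻¹). In this form the
interchange law `comp_act` applies, and the `H`-component becomes h h' h⁻¹ h = h h'. -/
theorem comp_mkArr (p : X.Obj) (h h' : H) :
    X.toAct.comp (X.mkArr (X.toAct.act₀ p (C.t h)) h') (X.mkArr p h) = X.mkArr p (h * h') := by
  have e : X.mkArr (X.toAct.act₀ p (C.t h)) h' =
      X.toAct.act₁ (X.toAct.one p) ⟨h * h' * h⁻¹, C.t h * 1⟩ := by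
    rw [mkArr, X.toAct.one_act, X.toAct.act₁_mul]
    congr 1
    ext
    · simp [C.α_t]
    · simp
  rw [e, mkArr, X.toAct.comp_act _ _ _ _ _ (by rw [X.toAct.src_one, X.toAct.tgt_one])]
  have h1 := X.toAct.comp_one (X.toAct.one p)
  rw [X.toAct.src_one] at h1
  rw [h1, mkArr, inv_mul_cancel_right]

theorem hPart_comp {b a : X.Arr} (h : X.toAct.tgt a = X.toAct.src b) :
    X.hPart (X.toAct.comp b a) = X.hPart a * X.hPart b := by
  rw [tgt_eq_act] at h
  conv_lhs =>
    rw [← mkArr_src_hPart b, ← mkArr_src_hPart a, ← h, comp_mkArr, hPart_mkArr]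

theorem arr_mkArr (F : Hom X Y) (p : X.Obj) (h : H) :
    F.arr (X.mkArr p h) = Y.mkArr (F.obj p) h := by
  rw [mkArr, F.arr_act, F.arr_one, mkArr]

theorem hPart_arr (F : Hom X Y) (a : X.Arr) : Y.hPart (F.arr a) = X.hPart a := by
  conv_lhs => rw [← mkArr_src_hPart a, arr_mkArr, hPart_mkArr]

/-- A 2-morphism is given by its `H`-components; naturality is automatic. -/
def TwoHom.ofHPart (F F' : Hom X Y) (b : X.Obj → H)
    (hb : ∀ p g, b (X.toAct.act₀ p g) = C.α g⁻¹ (b p))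
    (hF : ∀ p, Y.toAct.act₀ (F.obj p) (C.t (b p)) = F'.obj p) : TwoHom F F' where
  app p := Y.mkArr (F.obj p) (b p)
  src_app p := src_mkArr _ _
  tgt_app p := by rw [tgt_mkArr, hF]
  app_act p g := by rw [mkArr_act, F.obj_act, hb]
  naturality a := by
    have h1 : Y.toAct.tgt (F.arr a) =
        Y.toAct.src (Y.mkArr (F.obj (X.toAct.tgt a)) (b (X.toAct.tgt a))) := by
      rw [src_mkArr, F.tgt_arr]
    have h2 : Y.toAct.tgt (Y.mkArr (F.obj (X.toAct.src a)) (b (X.toAct.src a))) =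
        Y.toAct.src (F'.arr a) := by
      rw [tgt_mkArr, F'.src_arr, hF]
    apply arr_ext
    · rw [Y.toAct.src_comp _ _ h1, Y.toAct.src_comp _ _ h2, F.src_arr, src_mkArr]
    -- With h the `H`-component of `a`, equivariance and Peiffer give b(p · t(h)) = h⁻¹ b(p) h, so
    -- both sides are b(p) h.
    · rw [hPart_comp h1, hPart_comp h2, hPart_mkArr, hPart_mkArr, hPart_arr, hPart_arr,
        tgt_eq_act a, hb, ← map_inv, C.α_t]
      group

end TwoTorsor

end Torsors

/-! ### The modification equation as an identity in `H` -/

section Modifications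

variable {EG : Type*} [NormedAddCommGroup EG] [NormedSpace ℝ EG]
  {G : Type*} [TopologicalSpace G] [ChartedSpace EG G] [Group G]
  {EH : Type*} [NormedAddCommGroup EH] [NormedSpace ℝ EH]
  {H : Type*} [TopologicalSpace H] [ChartedSpace EH H] [Group H]
  {C : SmoothCrossedModule EG G EH H}
  {EM : Type*} [NormedAddCommGroup EM] [NormedSpace ℝ EM]
  {M : Type*} [TopologicalSpace M] [ChartedSpace EM M]
  {𝓕 𝓖 : TransportTwoFunctor C EM M}

open TwoTorsor

/-- Both composites start at ρ(y)(𝓕(γ)(p)), so only their `H`-components need to be compared.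
Equivariant functors preserve these, so 𝓖(γ) drops out. -/
theorem isModification_iff_hPart (ρ ρ' : PseudoNat 𝓕 𝓖)
    (𝓐 : ∀ x, TwoTorsor.TwoHom (ρ.app x) (ρ'.app x)) :
    IsModification ρ ρ' 𝓐 ↔ ∀ {x y : M} (γ : SPath EM x y) (p : (𝓕.obj x).Obj),
      (𝓖.obj y).hPart ((ρ.cell γ).app p) * (𝓖.obj x).hPart ((𝓐 x).app p) =
        (𝓖.obj y).hPart ((𝓐 y).app ((𝓕.map γ).obj p)) *
          (𝓖.obj y).hPart ((ρ'.cell γ).app p) := by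
  refine forall₂_congr fun x y => forall₂_congr fun γ p => ?_
  have h1 : (𝓖.obj y).toAct.tgt ((ρ.cell γ).app p) =
      (𝓖.obj y).toAct.src ((𝓖.map γ).arr ((𝓐 x).app p)) := by
    rw [(ρ.cell γ).tgt_app, (𝓖.map γ).src_arr, (𝓐 x).src_app]; rfl
  have h2 : (𝓖.obj y).toAct.tgt ((𝓐 y).app ((𝓕.map γ).obj p)) =
      (𝓖.obj y).toAct.src ((ρ'.cell γ).app p) := by
    rw [(𝓐 y).tgt_app, (ρ'.cell γ).src_app]; rfl
  have e1 := hPart_comp h1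
  have e2 := hPart_comp h2
  rw [hPart_arr] at e1
  rw [← e1, ← e2]
  refine ⟨fun h => congrArg _ h, fun h => arr_ext ?_ h⟩
  rw [(𝓖.obj y).toAct.src_comp _ _ h1, (𝓖.obj y).toAct.src_comp _ _ h2, (ρ.cell γ).src_app,
    (𝓐 y).src_app]
  rfl

/-- A constant path is its own concatenation with itself, so the component is an idempotent of the
group `H`. -/
theorem PseudoNat.hPart_cell_const (ρ : PseudoNat 𝓕 𝓖) {x y : M} (γ : SPath EM x y)
    (hγ : ∀ t, γ.toFun t = x) (p : (𝓕.obj x).Obj) :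
    (𝓖.obj y).hPart ((ρ.cell γ).app p) = 1 := by
  obtain rfl : y = x := by rw [← hγ 1, γ.target]
  have hc := ρ.cell_concat γ γ γ ⟨fun t _ => by rw [hγ, hγ], fun t _ => by rw [hγ, hγ]⟩ p
  rw [𝓖.map_arr_id γ (fun t _ => hγ t), 𝓕.map_obj_id γ (fun t _ => hγ t)] at hc
  have ht : (𝓖.obj y).toAct.tgt ((ρ.cell γ).app p) = (𝓖.obj y).toAct.src ((ρ.cell γ).app p) := by
    rw [(ρ.cell γ).tgt_app, (ρ.cell γ).src_app]
    change (𝓖.map γ).obj _ = (ρ.app y).obj ((𝓕.map γ).obj p)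
    rw [𝓖.map_obj_id γ (fun t _ => hγ t), 𝓕.map_obj_id γ (fun t _ => hγ t)]
  have h2 := congrArg (𝓖.obj y).hPart hc
  rw [hPart_comp ht] at h2
  exact left_eq_mul.mp h2

end Modifications

/-! ### Calculus of velocities of curves in manifolds -/

section Velocity

variable {E : Type*} [NormedAddCommGroup E] [NormedSpace ℝ E]
  {N : Type*} [TopologicalSpace N] [ChartedSpace E N]
  {E' : Type*} [NormedAddCommGroup E'] [NormedSpace ℝ E']
  {N' : Type*} [TopologicalSpace N'] [ChartedSpace E' N']
  {E'' : Type*} [NormedAddCommGroup E''] [NormedSpace ℝ E'']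
  {N'' : Type*} [TopologicalSpace N''] [ChartedSpace E'' N'']

theorem HasVelocityAt.unique {c : ℝ → N} {t : ℝ} {v w : E}
    (hv : HasVelocityAt (E := E) c t v) (hw : HasVelocityAt (E := E) c t w) : v = w := by
  have h := hasMFDerivAt_unique hv hw
  have h2 := congrArg (fun f : ℝ →L[ℝ] E => f 1) h
  have e : ∀ u : E, (ContinuousLinearMap.toSpanSingleton ℝ u) (1 : ℝ) = u := fun u => by simp
  rw [← e v, ← e w]
  exact h2

theorem hasVelocityAt_of_hasMFDerivAt {c : ℝ → N} {t : ℝ} {L : ℝ →L[ℝ] E} {v : E}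
    (h : HasMFDerivAt 𝓘(ℝ, ℝ) 𝓘(ℝ, E) c t L) (hL : L 1 = v) : HasVelocityAt (E := E) c t v := by
  have e : ContinuousLinearMap.toSpanSingleton ℝ v = L :=
    ContinuousLinearMap.ext_ring ((ContinuousLinearMap.toSpanSingleton_apply_one _ _).trans hL.symm)
  subst e
  exact h

theorem hasVelocityAt_velocity {c : ℝ → N} {t : ℝ}
    (hc : MDifferentiableAt 𝓘(ℝ, ℝ) 𝓘(ℝ, E) c t) :
    HasVelocityAt (E := E) c t (velocity (E := E) c t) :=
  hasVelocityAt_of_hasMFDerivAt hc.hasMFDerivAt rfl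

theorem HasVelocityAt.velocity_eq {c : ℝ → N} {t : ℝ} {v : E}
    (hv : HasVelocityAt (E := E) c t v) : velocity (E := E) c t = v :=
  (hasVelocityAt_velocity hv.mdifferentiableAt).unique hv

theorem HasVelocityAt.comp {c : ℝ → N} {t : ℝ} {v : E} {f : N → N'}
    (hf : MDifferentiableAt 𝓘(ℝ, E) 𝓘(ℝ, E') f (c t)) (hv : HasVelocityAt (E := E) c t v) :
    HasVelocityAt (E := E') (fun s => f (c s)) t (mfderiv 𝓘(ℝ, E) 𝓘(ℝ, E') f (c t) v) := by
  refine hasVelocityAt_of_hasMFDerivAt (HasMFDerivAt.comp t hf.hasMFDerivAt hv) ?_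
  exact congrArg (mfderiv 𝓘(ℝ, E) 𝓘(ℝ, E') f (c t))
    (ContinuousLinearMap.toSpanSingleton_apply_one (R₁ := ℝ) (M₁ := E) _)

theorem HasVelocityAt.comp₂ {c : ℝ → N} {d : ℝ → N'} {t : ℝ} {v : E} {w : E'} {f : N × N' → N''}
    (hf : MDifferentiableAt (𝓘(ℝ, E).prod 𝓘(ℝ, E')) 𝓘(ℝ, E'') f (c t, d t))
    (hv : HasVelocityAt (E := E) c t v) (hw : HasVelocityAt (E := E') d t w) :
    HasVelocityAt (E := E'') (fun s => f (c s, d s)) t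
      ((mfderiv 𝓘(ℝ, E) 𝓘(ℝ, E'') (fun z => f (z, d t)) (c t) v : E'') +
        (mfderiv 𝓘(ℝ, E') 𝓘(ℝ, E'') (fun z => f (c t, z)) (d t) w : E'')) := by
  refine hasVelocityAt_of_hasMFDerivAt
    (HasMFDerivAt.comp t hf.hasMFDerivAt (HasMFDerivAt.prodMk hv hw)) ?_
  have h1 : (ContinuousLinearMap.toSpanSingleton ℝ v) 1 = v :=
    ContinuousLinearMap.toSpanSingleton_apply_one (R₁ := ℝ) (M₁ := E) _
  have h2 : (ContinuousLinearMap.toSpanSingleton ℝ w) 1 = w :=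
    ContinuousLinearMap.toSpanSingleton_apply_one (R₁ := ℝ) (M₁ := E') _
  refine (congrArg (mfderiv (𝓘(ℝ, E).prod 𝓘(ℝ, E')) 𝓘(ℝ, E'') f (c t, d t))
    (Prod.ext h1 h2 : _ = ((v, w) : E × E'))).trans ?_
  exact mfderiv_prod_eq_add_apply hf

theorem hasVelocityAt_const (p : N) (t : ℝ) : HasVelocityAt (E := E) (fun _ => p) t (0 : E) := by
  exact hasVelocityAt_of_hasMFDerivAt (hasMFDerivAt_const (I := 𝓘(ℝ, ℝ)) (I' := 𝓘(ℝ, E)) p t)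
    rfl

theorem HasVelocityAt.hasDerivAt_chart {c : ℝ → N} {t : ℝ} {v : E}
    (hv : HasVelocityAt (E := E) c t v) :
    HasDerivAt (fun s => extChartAt 𝓘(ℝ, E) (c t) (c s)) v t := by
  have h : HasFDerivWithinAt (fun s => extChartAt 𝓘(ℝ, E) (c t) (c s))
      (ContinuousLinearMap.toSpanSingleton ℝ v) (Set.range (id : ℝ → ℝ)) t := hv.2
  rw [Set.range_id, hasFDerivWithinAt_univ] at h
  exact h

/-- Derivatives along curves are first computed at time 0, where the horizontal lift starts; this
transfers them to other times. -/
theorem HasVelocityAt.comp_add {c : ℝ → N} {t : ℝ} {v : E}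
    (hv : HasVelocityAt (E := E) (fun s => c (t + s)) 0 v) : HasVelocityAt (E := E) c t v := by
  have hf : HasMFDerivAt 𝓘(ℝ, ℝ) 𝓘(ℝ, ℝ) (fun s : ℝ => s - t) t (ContinuousLinearMap.id ℝ ℝ) :=
    ((hasFDerivAt_id t).sub_const t).hasMFDerivAt
  have hv' : HasMFDerivAt 𝓘(ℝ, ℝ) 𝓘(ℝ, E) (fun s => c (t + s)) (t - t)
      (ContinuousLinearMap.toSpanSingleton ℝ v) := by
    rw [sub_self]; exact hv
  have h := HasMFDerivAt.comp (f := fun s : ℝ => s - t) (g := fun s => c (t + s)) t hv' hf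
  have e : (fun s => c (t + s)) ∘ (fun s : ℝ => s - t) = c := by
    funext s; simp
  rw [e] at h
  exact hasVelocityAt_of_hasMFDerivAt h
    (ContinuousLinearMap.toSpanSingleton_apply_one (R₁ := ℝ) (M₁ := E) _)

/-- A curve in a Hausdorff manifold with vanishing velocity is constant. -/
theorem eq_of_hasVelocityAt_zero [CompleteSpace E] [IsManifold 𝓘(ℝ, E) ∞ N] [T2Space N]
    {c : ℝ → N} (hc : ∀ t, HasVelocityAt (E := E) c t (0 : E)) (s t : ℝ) : c s = c t := by
  have : IsManifold 𝓘(ℝ, E) (1 + 1) N := IsManifold.of_le (n := ∞) (by norm_cast)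
  have : IsManifold 𝓘(ℝ, E) 1 N := IsManifold.of_le (n := ∞) (by norm_cast)
  -- Such a curve is an integral curve of the zero vector field, hence equals the constant one by
  -- uniqueness.
  have key : ∀ d : ℝ → N, (∀ t, HasVelocityAt (E := E) d t (0 : E)) →
      IsMIntegralCurve d (fun x => (0 : TangentSpace 𝓘(ℝ, E) x)) := by
    intro d hd t
    have h := hd t
    have e : (ContinuousLinearMap.toSpanSingleton ℝ (0 : E)) =
        (1 : ℝ →L[ℝ] ℝ).smulRight (0 : E) := by ext; simp
    unfold HasVelocityAt at h
    exact HasMFDerivAt.congr_mfderiv h e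
  have hz : ContMDiff 𝓘(ℝ, E) (𝓘(ℝ, E).prod 𝓘(ℝ, E)) 1
      (fun x : N => (⟨x, 0⟩ : TangentBundle 𝓘(ℝ, E) N)) :=
    Bundle.contMDiff_zeroSection ℝ (TangentSpace 𝓘(ℝ, E) : N → Type _)
  exact congrFun (isMIntegralCurve_Ioo_eq_of_contMDiff_boundaryless (t₀ := t) hz (key c hc)
    (key (fun _ => c t) fun _ => hasVelocityAt_const _ _) rfl) s

end Velocity

/-! ### Velocities of curves in a Lie group -/

section GroupVelocity

variable {EH : Type*} [NormedAddCommGroup EH] [NormedSpace ℝ EH]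
  {H : Type*} [TopologicalSpace H] [ChartedSpace EH H] [Group H] [LieGroup 𝓘(ℝ, EH) ∞ H]

/-- At the identity both partial derivatives of multiplication are the identity map. Curves are
therefore translated to 1 before being multiplied, which keeps all velocities in the Lie algebra. -/
theorem hasVelocityAt_mul_of_eq_one {x y : ℝ → H} {t : ℝ} {X Y : EH}
    (hx1 : x t = 1) (hy1 : y t = 1)
    (hx : HasVelocityAt (E := EH) x t X) (hy : HasVelocityAt (E := EH) y t Y) :
    HasVelocityAt (E := EH) (fun s => x s * y s) t (X + Y) := by
  have hm : MDifferentiableAt (𝓘(ℝ, EH).prod 𝓘(ℝ, EH)) 𝓘(ℝ, EH)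
      (fun z : H × H => z.1 * z.2) (x t, y t) :=
    (contMDiff_mul 𝓘(ℝ, EH) ∞).mdifferentiable (by simp) _
  have h := HasVelocityAt.comp₂ hm hx hy
  -- Tangent spaces depend on the base point, so the factor is generalized to a variable that can be
  -- substituted by 1.
  have e1 : ∀ a b : H, b = 1 → (mfderiv 𝓘(ℝ, EH) 𝓘(ℝ, EH) (fun z : H => z * b) a X : EH) = X := by
    rintro a b rfl
    have e : (fun z : H => z * 1) = id := by funext z; exact mul_one z
    rw [e]
    exact congrArg (fun L : EH →L[ℝ] EH => L X) mfderiv_id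
  have e2 : ∀ a b : H, b = 1 → (mfderiv 𝓘(ℝ, EH) 𝓘(ℝ, EH) (fun z : H => b * z) a Y : EH) = Y := by
    rintro a b rfl
    have e : (fun z : H => 1 * z) = id := by funext z; exact one_mul z
    rw [e]
    exact congrArg (fun L : EH →L[ℝ] EH => L Y) mfderiv_id
  rw [← e1 (x t) (y t) hy1, ← e2 (y t) (x t) hx1]
  exact h

/-- Differentiate x x⁻¹ = 1 with the product rule at the identity. -/
theorem hasVelocityAt_inv_of_eq_one {x : ℝ → H} {t : ℝ} {X : EH}
    (hx1 : x t = 1) (hx : HasVelocityAt (E := EH) x t X) :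
    HasVelocityAt (E := EH) (fun s => (x s)⁻¹) t (-X) := by
  have hm : MDifferentiableAt 𝓘(ℝ, EH) 𝓘(ℝ, EH) (fun z : H => z⁻¹) (x t) :=
    (contMDiff_inv 𝓘(ℝ, EH) ∞).mdifferentiable (by simp) _
  have h := HasVelocityAt.comp hm hx
  have h2 := hasVelocityAt_mul_of_eq_one hx1 (by rw [hx1, inv_one]) hx h
  have e : (fun s => x s * (x s)⁻¹) = fun _ => (1 : H) := by funext s; exact mul_inv_cancel _
  rw [e] at h2
  have h3 := h2.unique (hasVelocityAt_const (E := EH) (1 : H) t)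
  rw [neg_eq_of_add_eq_zero_right h3]
  exact h

theorem HasVelocityAt.const_mul {x : ℝ → H} {t : ℝ} {X : EH} (k : H)
    (hx : HasVelocityAt (E := EH) x t X) :
    HasVelocityAt (E := EH) (fun s => k * x s) t
      (mfderiv 𝓘(ℝ, EH) 𝓘(ℝ, EH) (fun z : H => k * z) (x t) X : EH) :=
  hx.comp ((contMDiff_mul_left (I := 𝓘(ℝ, EH)) (n := ∞) (a := k)).mdifferentiable (by simp) _)

theorem HasVelocityAt.mul_const {x : ℝ → H} {t : ℝ} {X : EH} (k : H)
    (hx : HasVelocityAt (E := EH) x t X) :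
    HasVelocityAt (E := EH) (fun s => x s * k) t
      (mfderiv 𝓘(ℝ, EH) 𝓘(ℝ, EH) (fun z : H => z * k) (x t) X : EH) :=
  hx.comp ((contMDiff_mul_right (I := 𝓘(ℝ, EH)) (n := ∞) (a := k)).mdifferentiable (by simp) _)

theorem HasVelocityAt.zero_const_mul_mul_const {x : ℝ → H} {t : ℝ} (k l : H)
    (hx : HasVelocityAt (E := EH) x t (0 : EH)) :
    HasVelocityAt (E := EH) (fun s => k * x s * l) t (0 : EH) := by
  have h := (hx.const_mul k).mul_const l
  refine (congrArg (HasVelocityAt (E := EH) _ t) ?_).mp h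
  exact (congrArg (mfderiv 𝓘(ℝ, EH) 𝓘(ℝ, EH) (fun z : H => z * l) (k * x t))
    (map_zero (mfderiv 𝓘(ℝ, EH) 𝓘(ℝ, EH) (fun z : H => k * z) (x t)))).trans (map_zero _)

theorem HasVelocityAt.conj {x : ℝ → H} {t : ℝ} {X : EH} (hx1 : x t = 1) (k : H)
    (hx : HasVelocityAt (E := EH) x t X) :
    HasVelocityAt (E := EH) (fun s => k * x s * k⁻¹) t (Ad (EG := EH) k X) := by
  have hc : ContMDiff 𝓘(ℝ, EH) 𝓘(ℝ, EH) ∞ (fun z : H => k * z * k⁻¹) :=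
    (contMDiff_mul_right (a := k⁻¹)).comp (contMDiff_mul_left (a := k))
  have h := hx.comp (hc.mdifferentiable (by simp) (x t))
  have e : ∀ z : H, z = 1 → (mfderiv 𝓘(ℝ, EH) 𝓘(ℝ, EH) (fun z : H => k * z * k⁻¹) z X : EH) =
      Ad (EG := EH) k X := by
    rintro z rfl; rfl
  rw [← e _ hx1]
  exact h

/-- Right trivialization of the velocity of a curve. -/
theorem HasVelocityAt.rightTrivialize {x : ℝ → H} {t : ℝ} {X : EH}
    (hx : HasVelocityAt (E := EH) x t X) :
    HasVelocityAt (E := EH) (fun s => x s * (x t)⁻¹) t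
      (TwoTransport.rightTrivialize (EG := EH) (x t) X) :=
  hx.mul_const (x t)⁻¹

theorem rightTrivialize_rightTranslate (k : H) (X : EH) :
    rightTrivialize (EG := EH) k (rightTranslate (EG := EH) k X) = X := by
  have h1 : MDifferentiableAt 𝓘(ℝ, EH) 𝓘(ℝ, EH) (fun z : H => z * k) 1 :=
    (contMDiff_mul_right (I := 𝓘(ℝ, EH)) (n := ∞) (a := k)).mdifferentiable (by simp) _
  have h2 : MDifferentiableAt 𝓘(ℝ, EH) 𝓘(ℝ, EH) (fun z : H => z * k⁻¹) k :=
    (contMDiff_mul_right (I := 𝓘(ℝ, EH)) (n := ∞) (a := k⁻¹)).mdifferentiable (by simp) _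
  have h := mfderiv_comp_of_eq h2 h1 (one_mul k)
  have e : ((fun z : H => z * k⁻¹) ∘ fun z => z * k) = id := by
    funext z; simp
  rw [e, mfderiv_id] at h
  have e' : ∀ l : H, l = k → (mfderiv 𝓘(ℝ, EH) 𝓘(ℝ, EH) (fun z : H => z * k⁻¹) l : EH →L[ℝ] EH) =
      mfderiv 𝓘(ℝ, EH) 𝓘(ℝ, EH) (fun z : H => z * k⁻¹) k := by
    rintro l rfl; rfl
  have h' := (congrArg (fun L : EH →L[ℝ] EH => L X) h).symm
  exact (congrArg (fun L : EH →L[ℝ] EH => L (rightTranslate (EG := EH) k X))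
    (e' _ (one_mul k)).symm).trans h'

/-- Right trivialization of a curve given by its right logarithmic derivative. -/
theorem HasVelocityAt.mul_inv_of_rightTranslate {x : ℝ → H} {t : ℝ} {X : EH}
    (hx : HasVelocityAt (E := EH) x t (rightTranslate (EG := EH) (x t) X)) :
    HasVelocityAt (E := EH) (fun s => x s * (x t)⁻¹) t X := by
  have h := hx.rightTrivialize
  rwa [rightTrivialize_rightTranslate] at h

end GroupVelocity

/-! ### The modification equation along horizontal lifts -/

section HorizontalLift

open TwoTorsor

variable {EG : Type*} [NormedAddCommGroup EG] [NormedSpace ℝ EG]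
  {G : Type*} [TopologicalSpace G] [ChartedSpace EG G] [Group G]
  {EH : Type*} [NormedAddCommGroup EH] [NormedSpace ℝ EH]
  {H : Type*} [TopologicalSpace H] [ChartedSpace EH H] [Group H]
  {C : SmoothCrossedModule EG G EH H}
  {EM : Type*} [NormedAddCommGroup EM] [NormedSpace ℝ EM]
  {M : Type*} [TopologicalSpace M] [ChartedSpace EM M]
  {P₀ : Type*} [TopologicalSpace P₀] [ChartedSpace (EM × EG) P₀]
  {P₁ : Type*} [TopologicalSpace P₁] [ChartedSpace (EM × EG × EH) P₁]
  {P₀' : Type*} [TopologicalSpace P₀'] [ChartedSpace (EM × EG) P₀']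
  {P₁' : Type*} [TopologicalSpace P₁'] [ChartedSpace (EM × EG × EH) P₁']
  {P : PrincipalTwoBundle C EM M P₀ P₁} {P' : PrincipalTwoBundle C EM M P₀' P₁'}
  {D : TwoConnection P} {D' : TwoConnection P'}
  {𝓕 𝓖 : TransportTwoFunctor C EM M}
  (r : Realization 𝓕 D) (r' : Realization 𝓖 D')
  {ρ ρ' : PseudoNat 𝓕 𝓖}

/-- The horizontal lift of `γ` starting at `p`. -/
def Realization.lift {x y : M} (γ : SPath EM x y) (p : {p : P₀ // P.π₀ p = x}) (t : ℝ) : P₀ :=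
  ((r.e (γ.toFun t)).symm ((𝓕.map (γ.initial t)).obj (r.e x p))).1

theorem Realization.π₀_lift {x y : M} (γ : SPath EM x y) (p : {p : P₀ // P.π₀ p = x}) (t : ℝ) :
    P.π₀ (r.lift γ p t) = γ.toFun t :=
  ((r.e (γ.toFun t)).symm ((𝓕.map (γ.initial t)).obj (r.e x p))).2

theorem Realization.e_lift {x y : M} (γ : SPath EM x y) (p : {p : P₀ // P.π₀ p = x}) (t : ℝ) :
    r.e (γ.toFun t) ⟨r.lift γ p t, r.π₀_lift γ p t⟩ =
      (𝓕.map (γ.initial t)).obj (r.e x p) :=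
  (r.e (γ.toFun t)).apply_symm_apply _

/-- The curve of `H`-components of `ρ` along the initial pieces of `γ`. -/
noncomputable def PseudoNat.hCurve (ρ : PseudoNat 𝓕 𝓖) {x y : M} (γ : SPath EM x y)
    (p : (𝓕.obj x).Obj) (t : ℝ) : H :=
  (𝓖.obj (γ.toFun t)).hPart ((ρ.cell (γ.initial t)).app p)

theorem PseudoNat.hCurve_zero (ρ : PseudoNat 𝓕 𝓖) {x y : M} (γ : SPath EM x y)
    (p : (𝓕.obj x).Obj) : ρ.hCurve γ p 0 = 1 := by
  refine ρ.hPart_cell_const (γ.initial 0) (fun t => ?_) p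
  simp only [SPath.initial, mul_zero, γ.source]

variable (𝓐 : ∀ x, TwoTorsor.TwoHom (ρ.app x) (ρ'.app x))

theorem hMap_eq {x : M} (p : P₀) (hp : P.π₀ p = x) :
    hMap r 𝓐 p = (𝓖.obj x).hPart ((𝓐 x).app (r.e x ⟨p, hp⟩)) := by
  subst hp; rfl

theorem hMap_act (p : P₀) (g : G) :
    hMap r 𝓐 (P.act₀ p g) = C.α g⁻¹ (hMap r 𝓐 p) := by
  rw [hMap_eq r 𝓐 (P.act₀ p g) (P.π₀_act p g), r.e_act _ p rfl g, (𝓐 _).app_act, hPart_act]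
  rfl

variable {r r'} in
theorem hMap_obj {f f' : BundleHom D D'} (hρ : ρ.Corresponds r r' f)
    (hρ' : ρ'.Corresponds r r' f') (p : P₀) :
    P'.act₀ (f.F.obj p) (C.t (hMap r 𝓐 p)) = f'.F.obj p := by
  have h := tgt_eq_act ((𝓐 (P.π₀ p)).app (r.e (P.π₀ p) ⟨p, rfl⟩))
  rw [(𝓐 _).tgt_app, (𝓐 _).src_app, hρ.obj_eq, hρ'.obj_eq, ← r'.e_act] at h
  exact (congrArg Subtype.val ((r'.e (P.π₀ p)).injective h)).symm

/-- The modification condition in terms of horizontal lifts. -/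
theorem isModification_iff_lift :
    IsModification ρ ρ' 𝓐 ↔
      ∀ {x y : M} (γ : SPath EM x y) (p : {p : P₀ // P.π₀ p = x}) (t : ℝ),
        ρ.hCurve γ (r.e x p) t * hMap r 𝓐 p.1 =
          hMap r 𝓐 (r.lift γ p t) * ρ'.hCurve γ (r.e x p) t := by
  rw [isModification_iff_hPart]
  constructor
  · intro h x y γ p t
    rw [hMap_eq r 𝓐 p.1 p.2, hMap_eq r 𝓐 _ (r.π₀_lift γ p t), r.e_lift]
    exact h (γ.initial t) (r.e x p)
  · intro h x y γ q
    obtain ⟨p, rfl⟩ := (r.e x).surjective q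
    have h1 := h γ p 1
    rw [hMap_eq r 𝓐 p.1 p.2, hMap_eq r 𝓐 _ (r.π₀_lift γ p 1), r.e_lift] at h1
    -- The initial piece at time 1 is the whole path. Substituting the end point by `c 1` gives both
    -- paths the same type.
    obtain ⟨c, hc, h0, rfl⟩ := γ
    have e : SPath.initial (⟨c, hc, h0, rfl⟩ : SPath EM x (c 1)) 1 = ⟨c, hc, h0, rfl⟩ := by
      simp only [SPath.initial, mul_one]
    simp only [PseudoNat.hCurve] at h1
    rw [e] at h1
    exact h1

end HorizontalLift

/-! ### Values of a modification along arbitrary curves in the bundle -/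

section Curves

open TwoTorsor

variable {EG : Type*} [NormedAddCommGroup EG] [NormedSpace ℝ EG]
  {G : Type*} [TopologicalSpace G] [ChartedSpace EG G] [Group G]
  {EH : Type*} [NormedAddCommGroup EH] [NormedSpace ℝ EH]
  {H : Type*} [TopologicalSpace H] [ChartedSpace EH H] [Group H]
  {C : SmoothCrossedModule EG G EH H}
  {EM : Type*} [NormedAddCommGroup EM] [NormedSpace ℝ EM]
  {M : Type*} [TopologicalSpace M] [ChartedSpace EM M]
  {P₀ : Type*} [TopologicalSpace P₀] [ChartedSpace (EM × EG) P₀]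
  {P₁ : Type*} [TopologicalSpace P₁] [ChartedSpace (EM × EG × EH) P₁]
  {P₀' : Type*} [TopologicalSpace P₀'] [ChartedSpace (EM × EG) P₀']
  {P₁' : Type*} [TopologicalSpace P₁'] [ChartedSpace (EM × EG × EH) P₁']
  {P : PrincipalTwoBundle C EM M P₀ P₁} {P' : PrincipalTwoBundle C EM M P₀' P₁'}
  {D : TwoConnection P} {D' : TwoConnection P'}
  {𝓕 𝓖 : TransportTwoFunctor C EM M}
  {r : Realization 𝓕 D} {r' : Realization 𝓖 D'}
  {ρ ρ' : PseudoNat 𝓕 𝓖} {f f' : BundleHom D D'}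

/-- The equation h' = -φ(c') h, translated so that the curve passes through 1 at time `t`. -/
theorem PseudoNat.Corresponds.hasVelocityAt_hCurve [LieGroup 𝓘(ℝ, EH) ∞ H]
    (hρ : ρ.Corresponds r r' f) {x y : M}
    (γ : SPath EM x y) (p : {p : P₀ // P.π₀ p = x}) (t : ℝ) :
    HasVelocityAt (E := EH) (fun s => ρ.hCurve γ (r.e x p) s * (ρ.hCurve γ (r.e x p) t)⁻¹) t
      (-(f.φ (r.lift γ p t) (velocity (E := EM × EG) (r.lift γ p) t)) : EH) :=
  HasVelocityAt.mul_inv_of_rightTranslate (hρ.cell_eq γ p t)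

theorem PseudoNat.Corresponds.hasVelocityAt_hCurve_zero [LieGroup 𝓘(ℝ, EH) ∞ H]
    (hρ : ρ.Corresponds r r' f) {x y : M}
    (γ : SPath EM x y) (p : {p : P₀ // P.π₀ p = x}) :
    HasVelocityAt (E := EH) (ρ.hCurve γ (r.e x p)) 0
      (-(f.φ (r.lift γ p 0) (velocity (E := EM × EG) (r.lift γ p) 0)) : EH) := by
  have h := hρ.hasVelocityAt_hCurve γ p 0
  have e : (fun s => ρ.hCurve γ (r.e x p) s * (ρ.hCurve γ (r.e x p) 0)⁻¹) =
      ρ.hCurve γ (r.e x p) := by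
    funext s
    rw [ρ.hCurve_zero, inv_one, mul_one]
  rw [e] at h
  exact h

/-- Additivity across base points that are only propositionally equal, such as `K 0` and the
starting point of its horizontal lift. -/
theorem form_add {V : Type*} [NormedAddCommGroup V] [NormedSpace ℝ V]
    (θ : ∀ p : P₀, TangentSpace 𝓘(ℝ, EM × EG) p →L[ℝ] V) {p q : P₀} (h : q = p)
    {u v w : EM × EG} (hu : u = v + w) :
    θ q u = (θ p v : V) + (θ p w : V) := by
  subst h hu
  exact map_add (θ q) v w

theorem PrincipalTwoBundle.velocity_act {c K : ℝ → P₀} {g : ℝ → G} {v : EM × EG} {ξ : EG}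
    (hc : HasVelocityAt (E := EM × EG) c 0 v) (hg : HasVelocityAt (E := EG) g 0 ξ) (hg0 : g 0 = 1)
    (hK : ∀ t, K t = P.act₀ (c t) (g t)) :
    HasVelocityAt (E := EM × EG) K 0
      (HAdd.hAdd (α := EM × EG) (β := EM × EG) v (P.fundamental (c 0) ξ)) := by
  have hm : MDifferentiableAt (𝓘(ℝ, EM × EG).prod 𝓘(ℝ, EG)) 𝓘(ℝ, EM × EG)
      (fun z : P₀ × G => P.act₀ z.1 z.2) (c 0, g 0) :=
    P.smooth_act₀.mdifferentiable (by simp) _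
  have h := HasVelocityAt.comp₂ hm hc hg
  obtain rfl : K = fun t => P.act₀ (c t) (g t) := funext hK
  have e1 : ∀ b : G, b = 1 →
      (mfderiv 𝓘(ℝ, EM × EG) 𝓘(ℝ, EM × EG) (fun z => P.act₀ z b) (c 0) v : EM × EG) = v := by
    rintro b rfl
    have e : (fun z => P.act₀ z (1 : G)) = id := by funext z; exact P.act₀_one z
    rw [e]
    exact congrArg (fun L : EM × EG →L[ℝ] EM × EG => L v) mfderiv_id
  have e2 : ∀ b : G, b = 1 →
      (mfderiv 𝓘(ℝ, EG) 𝓘(ℝ, EM × EG) (fun z => P.act₀ (c 0) z) b ξ : EM × EG) =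
        P.fundamental (c 0) ξ := by
    rintro b rfl; rfl
  rw [← e1 _ hg0, ← e2 _ hg0]
  exact h

/-- Along a smooth curve `K` in `P₀`, the map `a = (hMap r 𝓐)⁻¹` of a modification moves by
curves through `1` whose velocities are given by the forms `φ'`, `φ` and `A`. -/
theorem IsModification.exists_curves [LieGroup 𝓘(ℝ, EG) ∞ G] [LieGroup 𝓘(ℝ, EH) ∞ H]
    (hρ : ρ.Corresponds r r' f) (hρ' : ρ'.Corresponds r r' f')
    {𝓐 : ∀ x, TwoTorsor.TwoHom (ρ.app x) (ρ'.app x)} (h𝓐 : IsModification ρ ρ' 𝓐)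
    {K : ℝ → P₀} (hK : ContMDiff 𝓘(ℝ, ℝ) 𝓘(ℝ, EM × EG) ∞ K) :
    ∃ (g : ℝ → G) (x y : ℝ → H), g 0 = 1 ∧ x 0 = 1 ∧ y 0 = 1 ∧
      HasVelocityAt (E := EG) g 0 (-(D.A (K 0) (velocity (E := EM × EG) K 0)) : EG) ∧
      HasVelocityAt (E := EH) x 0 (-(f'.φ (K 0) (velocity (E := EM × EG) K 0)) : EH) ∧
      HasVelocityAt (E := EH) y 0 (f.φ (K 0) (velocity (E := EM × EG) K 0) : EH) ∧
      ∀ t, (hMap r 𝓐 (K t))⁻¹ = C.α (g t) (x t * ((hMap r 𝓐 (K 0))⁻¹ * y t)) := by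
  -- The horizontal lift from K(0) of the projected curve lies in the same fibres as K, so the two
  -- differ by a curve g in `G`, smooth because division is.
  let γ : SPath EM (P.π₀ (K 0)) (P.π₀ (K 1)) :=
    ⟨fun t => P.π₀ (K t), P.smooth_π₀.comp hK, rfl, rfl⟩
  let p : {p : P₀ // P.π₀ p = P.π₀ (K 0)} := ⟨K 0, rfl⟩
  obtain ⟨hc, hc0, hcA⟩ := r.horizontal γ p
  change ContMDiff _ _ _ (r.lift γ p) at hc
  change r.lift γ p 0 = K 0 at hc0
  change ∀ t, D.A (r.lift γ p t) (velocity (E := EM × EG) (r.lift γ p) t) = 0 at hcA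
  have hπ : ∀ t, P.π₀ (K t) = P.π₀ (r.lift γ p t) := fun t => (r.π₀_lift γ p t).symm
  let g : ℝ → G := fun t => P.div₀ (K t) (r.lift γ p t)
  have hact : ∀ t, K t = P.act₀ (r.lift γ p t) (g t) := fun t => (P.act_div₀ _ _ (hπ t)).symm
  have hg0 : g 0 = 1 := by
    have h := P.div_act₀ (K 0) 1
    rw [P.act₀_one] at h
    change P.div₀ (K 0) (r.lift γ p 0) = 1
    rw [hc0, h]
  have hgs : ContMDiff 𝓘(ℝ, ℝ) 𝓘(ℝ, EG) ∞ g := by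
    have h := P.smooth_div₀.comp (s := Set.univ)
      ((hK.prodMk hc).contMDiffOn (s := Set.univ)) (fun t _ => hπ t)
    exact contMDiffOn_univ.mp h
  have hgv := hasVelocityAt_velocity (hgs.mdifferentiable (by simp) 0)
  have hcv := hasVelocityAt_velocity (hc.mdifferentiable (by simp) 0)
  have hKv := (PrincipalTwoBundle.velocity_act (P := P) hcv hgv hg0 hact).velocity_eq
  have hA := form_add D.A hc0.symm hKv
  have hφ := form_add f.φ hc0.symm hKv
  have hφ' := form_add f'.φ hc0.symm hKv
  -- The connection vanishes on the lift and returns the velocity of g; φ and φ' are horizontal and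
  -- ignore the contribution of g.
  replace hA := hA.trans
    ((congrArg₂ (· + ·) (hcA 0) (D.A_fundamental _ _)).trans (zero_add (velocity (E := EG) g 0)))
  replace hφ := hφ.trans ((congrArg (_ + ·) (f.φ_horizontal _ _)).trans (add_zero _))
  replace hφ' := hφ'.trans ((congrArg (_ + ·) (f'.φ_horizontal _ _)).trans (add_zero _))
  refine ⟨fun t => (g t)⁻¹, ρ'.hCurve γ (r.e _ p), fun t => (ρ.hCurve γ (r.e _ p) t)⁻¹,
    inv_eq_one.mpr hg0, ρ'.hCurve_zero _ _, inv_eq_one.mpr (ρ.hCurve_zero _ _), ?_, ?_, ?_, ?_⟩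
  · rw [hA]
    exact hasVelocityAt_inv_of_eq_one hg0 hgv
  · rw [hφ']
    exact hρ'.hasVelocityAt_hCurve_zero γ p
  · rw [hφ]
    have h := hasVelocityAt_inv_of_eq_one (ρ.hCurve_zero _ _) (hρ.hasVelocityAt_hCurve_zero γ p)
    rw [neg_neg] at h
    exact h
  · intro t
    have h := (isModification_iff_lift r 𝓐).mp h𝓐 γ p t
    rw [hact t, hMap_act, ← map_inv]
    congr 1
    rw [← mul_assoc, eq_mul_inv_iff_mul_eq, inv_mul_eq_iff_eq_mul, ← mul_assoc,
      eq_mul_inv_iff_mul_eq]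
    exact h

end Curves

/-! ### From bundle 2-morphisms to modifications, and the logarithmic derivative of a -/

section Correspondence

open TwoTorsor

variable {EG : Type*} [NormedAddCommGroup EG] [NormedSpace ℝ EG]
  {G : Type*} [TopologicalSpace G] [ChartedSpace EG G] [Group G]
  {EH : Type*} [NormedAddCommGroup EH] [NormedSpace ℝ EH]
  {H : Type*} [TopologicalSpace H] [ChartedSpace EH H] [Group H]
  {C : SmoothCrossedModule EG G EH H}
  {EM : Type*} [NormedAddCommGroup EM] [NormedSpace ℝ EM]
  {M : Type*} [TopologicalSpace M] [ChartedSpace EM M]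
  {P₀ : Type*} [TopologicalSpace P₀] [ChartedSpace (EM × EG) P₀]
  {P₁ : Type*} [TopologicalSpace P₁] [ChartedSpace (EM × EG × EH) P₁]
  {P₀' : Type*} [TopologicalSpace P₀'] [ChartedSpace (EM × EG) P₀']
  {P₁' : Type*} [TopologicalSpace P₁'] [ChartedSpace (EM × EG × EH) P₁']
  {P : PrincipalTwoBundle C EM M P₀ P₁} {P' : PrincipalTwoBundle C EM M P₀' P₁'}
  {D : TwoConnection P} {D' : TwoConnection P'}
  {𝓕 𝓖 : TransportTwoFunctor C EM M}
  {r : Realization 𝓕 D} {r' : Realization 𝓖 D'}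
  {ρ ρ' : PseudoNat 𝓕 𝓖} {f f' : BundleHom D D'}

/-- With k = a(K(0)), the curve is α(g, x · k y k⁻¹ · k) k⁻¹, and g, x, k y k⁻¹ all pass through 1.
The factor g contributes the orbit term, x contributes -φ', and conjugating y contributes Ad_k φ. No
regularity of a is presupposed. -/
theorem IsModification.hasVelocityAt_mul_inv [LieGroup 𝓘(ℝ, EG) ∞ G] [LieGroup 𝓘(ℝ, EH) ∞ H]
    (hρ : ρ.Corresponds r r' f) (hρ' : ρ'.Corresponds r r' f')
    {𝓐 : ∀ x, TwoTorsor.TwoHom (ρ.app x) (ρ'.app x)} (h𝓐 : IsModification ρ ρ' 𝓐)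
    {K : ℝ → P₀} (hK : ContMDiff 𝓘(ℝ, ℝ) 𝓘(ℝ, EM × EG) ∞ K) {a : P₀ → H}
    (ha : ∀ p, a p = (hMap r 𝓐 p)⁻¹) :
    HasVelocityAt (E := EH) (fun t => a (K t) * (a (K 0))⁻¹) 0
      (Ad (EG := EH) (a (K 0)) (f.φ (K 0) (velocity (E := EM × EG) K 0)) -
        C.αOrbit (a (K 0)) (D.A (K 0) (velocity (E := EM × EG) K 0)) -
        f'.φ (K 0) (velocity (E := EM × EG) K 0) : EH) := by
  obtain ⟨g, x, y, hg0, hx0, hy0, hg, hx, hy, h⟩ := h𝓐.exists_curves hρ hρ' hK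
  simp only [← ha] at h
  generalize a (K 0) = k at *
  generalize f.φ (K 0) (velocity (E := EM × EG) K 0) = Y at *
  generalize f'.φ (K 0) (velocity (E := EM × EG) K 0) = X at *
  generalize D.A (K 0) (velocity (E := EM × EG) K 0) = Z at *
  have hy' := hy.conj hy0 k
  have hw := hasVelocityAt_mul_of_eq_one hx0 (by rw [hy0, mul_one, mul_inv_cancel]) hx hy'
  have hl : x 0 * (k * y 0 * k⁻¹) = 1 := by rw [hx0, hy0]; group
  have hm : MDifferentiableAt (𝓘(ℝ, EG).prod 𝓘(ℝ, EH)) 𝓘(ℝ, EH)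
      (fun z : G × H => C.α z.1 (z.2 * k) * k⁻¹) (g 0, x 0 * (k * y 0 * k⁻¹)) := by
    have h1 : ContMDiff (𝓘(ℝ, EG).prod 𝓘(ℝ, EH)) (𝓘(ℝ, EG).prod 𝓘(ℝ, EH)) ∞
        (fun z : G × H => (z.1, z.2 * k)) :=
      contMDiff_fst.prodMk ((contMDiff_mul_right (a := k)).comp contMDiff_snd)
    exact ((contMDiff_mul_right (a := k⁻¹)).comp (C.smooth_α.comp h1)).mdifferentiable (by simp) _
  have hv := HasVelocityAt.comp₂ hm hg hw
  have e1 : ∀ (b : G) (l : H), b = 1 → l = 1 →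
      (mfderiv 𝓘(ℝ, EG) 𝓘(ℝ, EH) (fun z : G => C.α z (l * k) * k⁻¹) b (-Z) : EH) =
        -(C.αOrbit k Z) := by
    rintro b l rfl rfl
    rw [one_mul]
    exact map_neg (C.αOrbit k) Z
  have e2 : ∀ (b : G) (l : H) (W : EH), b = 1 →
      (mfderiv 𝓘(ℝ, EH) 𝓘(ℝ, EH) (fun z : H => C.α b (z * k) * k⁻¹) l W : EH) = W := by
    rintro b l W rfl
    have e : (fun z : H => C.α 1 (z * k) * k⁻¹) = id := by
      funext z; rw [map_one]; exact mul_inv_cancel_right z k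
    rw [e]
    exact congrArg (fun L : EH →L[ℝ] EH => L W) mfderiv_id
  have e3 : (fun t => a (K t) * k⁻¹) =
      fun t => C.α (g t) (x t * (k * y t * k⁻¹) * k) * k⁻¹ := by
    funext t
    have e : x t * (k * y t * k⁻¹) * k = x t * (k * y t) := by group
    rw [h t, e]
  have e4 : Ad (EG := EH) k Y - C.αOrbit k Z - X = -(C.αOrbit k Z) + (-X + Ad (EG := EH) k Y) := by
    abel
  rw [e3]
  refine (congrArg (HasVelocityAt (E := EH) _ 0) ?_).mp hv
  refine Eq.trans ?_ e4.symm
  exact congrArg₂ (· + ·) (e1 _ _ hg0 hl)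
    (e2 _ _ _ hg0)

theorem IsBundleTwoHom.isModification [CompleteSpace EH] [T2Space H]
    [LieGroup 𝓘(ℝ, EH) ∞ H]
    (hρ : ρ.Corresponds r r' f) (hρ' : ρ'.Corresponds r r' f')
    {𝓐 : ∀ x, TwoTorsor.TwoHom (ρ.app x) (ρ'.app x)}
    (h : IsBundleTwoHom f f' (fun p => (hMap r 𝓐 p)⁻¹)) : IsModification ρ ρ' 𝓐 := by
  rw [isModification_iff_lift r]
  intro x y γ p t
  obtain ⟨hc, hc0, hcA⟩ := r.horizontal γ p
  change ContMDiff _ _ _ (r.lift γ p) at hc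
  change r.lift γ p 0 = p at hc0
  change ∀ t, D.A (r.lift γ p t) (velocity (E := EM × EG) (r.lift γ p) t) = 0 at hcA
  obtain ⟨a, ha⟩ : ∃ a : P₀ → H, a = fun p => (hMap r 𝓐 p)⁻¹ := ⟨_, rfl⟩
  rw [← ha] at h
  set c := r.lift γ p with hcdef
  set k := ρ.hCurve γ (r.e x p) with hk
  set k' := ρ'.hCurve γ (r.e x p) with hk'
  -- Up to constant left and right factors this is a product of three curves that equal 1 at `t₀`,
  -- so its velocity is computed by adding theirs.
  have hu : ∀ t₀, HasVelocityAt (E := EH) (fun t => (k' t)⁻¹ * (a (c t) * k t)) t₀ (0 : EH) := by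
    intro t₀
    have h1 := hasVelocityAt_inv_of_eq_one (x := fun s => k' s * (k' t₀)⁻¹) (mul_inv_cancel _)
      (hρ'.hasVelocityAt_hCurve γ p t₀)
    have hcv := hasVelocityAt_velocity (hc.mdifferentiable (by simp) t₀)
    have h2 := (hcv.comp (h.smooth.mdifferentiable (by simp) (c t₀))).rightTrivialize
    have h3 := HasVelocityAt.conj (x := fun s => k s * (k t₀)⁻¹) (mul_inv_cancel _) (a (c t₀))
      (hρ.hasVelocityAt_hCurve γ p t₀)
    have h4 := hasVelocityAt_mul_of_eq_one (x := fun s => a (c s) * (a (c t₀))⁻¹)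
      (y := fun s => a (c t₀) * (k s * (k t₀)⁻¹) * (a (c t₀))⁻¹) (mul_inv_cancel _)
      (by group) h2 h3
    have h5 := hasVelocityAt_mul_of_eq_one (x := fun s => (k' s * (k' t₀)⁻¹)⁻¹)
      (y := fun s => a (c s) * (a (c t₀))⁻¹ * (a (c t₀) * (k s * (k t₀)⁻¹) * (a (c t₀))⁻¹))
      (by group) (by group) h1 h4
    -- On the horizontal velocity the A-term disappears, and what remains is exactly the
    -- cancellation of the three velocities.
    have hφ := h.φ_eq (c t₀) (velocity (E := EM × EG) c t₀)
    rw [hcA t₀, map_zero] at hφ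
    have h0 : ∀ (L : EH →L[ℝ] EH) (X X' Y : EH), X' = L X - 0 - Y →
        - -X' + (Y + L (-X)) = 0 := by
      rintro L X X' Y rfl
      rw [map_neg]; abel
    have h6 := HasVelocityAt.zero_const_mul_mul_const (k' t₀)⁻¹ (a (c t₀) * k t₀)
      ((congrArg (HasVelocityAt (E := EH) _ t₀) (h0 _ _ _ _ hφ)).mp h5)
    have e : (fun t => (k' t)⁻¹ * (a (c t) * k t)) = fun s => (k' t₀)⁻¹ *
        ((k' s * (k' t₀)⁻¹)⁻¹ * (a (c s) * (a (c t₀))⁻¹ *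
          (a (c t₀) * (k s * (k t₀)⁻¹) * (a (c t₀))⁻¹))) * (a (c t₀) * k t₀) := by
      funext s; group
    rw [e]
    exact h6
  have hconst := eq_of_hasVelocityAt_zero hu t 0
  simp only [hk, hk', PseudoNat.hCurve_zero, hcdef, inv_one, one_mul, mul_one] at hconst
  rw [inv_mul_eq_iff_eq_mul] at hconst
  subst ha
  change (hMap r 𝓐 (c t))⁻¹ * k t = k' t * (hMap r 𝓐 (c 0))⁻¹ at hconst
  rwa [hc0, inv_mul_eq_iff_eq_mul, ← mul_assoc, eq_mul_inv_iff_mul_eq] at hconst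

/-- The family of 2-morphisms with given `H`-components. -/
def twoHomOfMap (hρ : ρ.Corresponds r r' f) (hρ' : ρ'.Corresponds r r' f') {a : P₀ → H}
    (h1 : ∀ p g, a (P.act₀ p g) = C.α g⁻¹ (a p))
    (h2 : ∀ p, P'.act₀ (f'.F.obj p) (C.t (a p)) = f.F.obj p) (x : M) :
    TwoTorsor.TwoHom (ρ.app x) (ρ'.app x) :=
  TwoHom.ofHPart (ρ.app x) (ρ'.app x) (fun q => (a ((r.e x).symm q).1)⁻¹)
    (by
      intro q g
      obtain ⟨p, rfl⟩ := (r.e x).surjective q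
      rw [← r.e_act x p.1 p.2 g, Equiv.symm_apply_apply, Equiv.symm_apply_apply, h1,
        map_inv (C.α g⁻¹)])
    (by
      intro q
      obtain ⟨p, rfl⟩ := (r.e x).surjective q
      rw [hρ.obj_eq x p.1 p.2, hρ'.obj_eq x p.1 p.2, ← r'.e_act, Equiv.symm_apply_apply]
      congr 2
      rw [← h2 p.1, P'.act₀_mul, map_inv, mul_inv_cancel, P'.act₀_one])

theorem hMap_twoHomOfMap (hρ : ρ.Corresponds r r' f) (hρ' : ρ'.Corresponds r r' f') {a : P₀ → H}
    (h1 : ∀ p g, a (P.act₀ p g) = C.α g⁻¹ (a p))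
    (h2 : ∀ p, P'.act₀ (f'.F.obj p) (C.t (a p)) = f.F.obj p) (p : P₀) :
    (hMap r (twoHomOfMap hρ hρ' h1 h2) p)⁻¹ = a p := by
  rw [hMap]
  simp only [twoHomOfMap, TwoHom.ofHPart, hPart_mkArr, Equiv.symm_apply_apply, inv_inv]

theorem hMap_injective (r : Realization 𝓕 D) {𝓐 𝓐' : ∀ x, TwoTorsor.TwoHom (ρ.app x) (ρ'.app x)}
    (h : ∀ p, hMap r 𝓐 p = hMap r 𝓐' p) : 𝓐 = 𝓐' := by
  funext x
  ext q
  obtain ⟨p, rfl⟩ := (r.e x).surjective q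
  refine arr_ext (by rw [(𝓐 x).src_app, (𝓐' x).src_app]) ?_
  have := h p.1
  rwa [hMap_eq r 𝓐 p.1 p.2, hMap_eq r 𝓐' p.1 p.2] at this

end Correspondence

/-! ### Regularity of solutions of a total differential equation -/

section TotalDifferentialEquation

open Set Metric Filter Topology

variable {E : Type*} [NormedAddCommGroup E] [NormedSpace ℝ E]
  {F : Type*} [NormedAddCommGroup F] [NormedSpace ℝ F]

/-- A map whose derivatives along the curves `x + sin s • v` are given by a linear map depending
continuously on the point is differentiable. -/
theorem hasFDerivAt_of_sin_curves {f : E → F} {L : E → E →L[ℝ] F} {x : E} {r : ℝ} (hr : 0 < r)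
    (hL : ContinuousAt L x)
    (hf : ∀ v, ‖v‖ < r → ∀ t : ℝ, HasDerivAt (fun s : ℝ => f (x + Real.sin s • v))
      (Real.cos t • L (x + Real.sin t • v) v) t) : HasFDerivAt f (L x) x := by
  rw [hasFDerivAt_iff_isLittleO_nhds_zero, Asymptotics.isLittleO_iff]
  intro ε hε
  obtain ⟨δ, hδ, hLδ⟩ := Metric.continuousAt_iff.mp hL (ε / 2) (by positivity)
  filter_upwards [ball_mem_nhds (0 : E) (lt_min hr hδ)] with v hv
  rw [mem_ball_zero_iff, lt_min_iff] at hv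
  -- Mean value inequality on [0, π/2], where sin runs from 0 to 1 and the curve from x to x + v.
  -- The length π/2 ≤ 2 explains the bound ε/2.
  have hd : ∀ t ∈ Icc (0 : ℝ) (Real.pi / 2),
      HasDerivWithinAt (fun s : ℝ => f (x + Real.sin s • v) - Real.sin s • L x v)
        (Real.cos t • L (x + Real.sin t • v) v - Real.cos t • L x v)
        (Icc (0 : ℝ) (Real.pi / 2)) t := fun t _ =>
    ((hf v hv.1 t).sub ((Real.hasDerivAt_sin t).smul_const _)).hasDerivWithinAt
  have hb : ∀ t ∈ Ico (0 : ℝ) (Real.pi / 2),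
      ‖Real.cos t • L (x + Real.sin t • v) v - Real.cos t • L x v‖ ≤ ε / 2 * ‖v‖ := by
    intro t _
    rw [← smul_sub, ← sub_apply, norm_smul]
    have h1 : ‖Real.cos t‖ ≤ 1 := Real.abs_cos_le_one t
    have h2 : ‖L (x + Real.sin t • v) - L x‖ ≤ ε / 2 := by
      rw [← dist_eq_norm]
      refine (hLδ ?_).le
      rw [dist_eq_norm, add_sub_cancel_left, norm_smul]
      have h3 : ‖Real.sin t‖ ≤ 1 := Real.abs_sin_le_one t
      exact (mul_le_of_le_one_left (norm_nonneg v) h3).trans_lt hv.2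
    calc _ ≤ 1 * (ε / 2 * ‖v‖) := by
          gcongr
          exact (L (x + Real.sin t • v) - L x).le_of_opNorm_le h2 v
      _ = _ := one_mul _
  have h := norm_image_sub_le_of_norm_deriv_le_segment' hd hb (Real.pi / 2)
    ⟨by positivity, le_rfl⟩
  simp only [Real.sin_pi_div_two, one_smul, Real.sin_zero, zero_smul, add_zero, sub_zero] at h
  rw [sub_right_comm] at h
  refine h.trans ?_
  have hpi : Real.pi / 2 ≤ 2 := by linarith [Real.pi_le_four]
  calc ε / 2 * ‖v‖ * (Real.pi / 2) ≤ ε / 2 * ‖v‖ * 2 := by gcongr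
    _ = ε * ‖v‖ := by ring

variable {N : Type*} [TopologicalSpace N]

/-- `b` solves the total differential equation `db = Θ(·, b)` along the curves
`y + sin s • v` in `U`, in the chart `ψ`. -/
def SolvesAlongCurves (ψ : OpenPartialHomeomorph N F) (Θ : E × F → E →L[ℝ] F) (U : Set E)
    (b : E → N) : Prop :=
  ∀ y v : E, (∀ s : ℝ, y + Real.sin s • v ∈ U) →
    Continuous (fun s : ℝ => b (y + Real.sin s • v)) ∧
    ∀ t : ℝ, b (y + Real.sin t • v) ∈ ψ.source →
      HasDerivAt (fun s : ℝ => ψ (b (y + Real.sin s • v)))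
        (Real.cos t • Θ (y + Real.sin t • v, ψ (b (y + Real.sin t • v))) v) t

variable [T2Space N] [FiniteDimensional ℝ F] {ψ : OpenPartialHomeomorph N F}
  {Θ : E × F → E →L[ℝ] F} {U : Set E} {b : E → N}

/-- Paths are parametrized by all of ℝ, and a straight line would leave the chart. Replacing s by
sin s keeps the curve in a ball, while it still has velocity v at 0 and reaches y + v at π/2. -/
theorem add_sin_smul_mem_ball {y v : E} {ρ : ℝ} (hv : ‖v‖ < ρ) (s : ℝ) :
    y + Real.sin s • v ∈ ball y ρ := by
  rw [mem_ball, dist_eq_norm, add_sub_cancel_left, norm_smul]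
  have h3 : ‖Real.sin s‖ ≤ 1 := Real.abs_sin_le_one s
  exact (mul_le_of_le_one_left (norm_nonneg v) h3).trans_lt hv

/-- A first-exit argument. While the solution stays in the coordinate ball of radius ρ, the bound on
Θ keeps it within K‖v‖ · 2 < ρ/2 of its start, so it cannot leave that ball before time π/2. -/
theorem SolvesAlongCurves.bound (hb : SolvesAlongCurves ψ Θ U b) {y : E}
    (hy : b y ∈ ψ.source) {ρ K : ℝ} (hK : 0 ≤ K) (hUρ : ball y ρ ⊆ U)
    (hψρ : ball (ψ (b y)) ρ ⊆ ψ.target)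
    (hΘ : ∀ y' ∈ ball y ρ, ∀ z ∈ ball (ψ (b y)) ρ, ‖Θ (y', z)‖ ≤ K) {v : E} (hv : ‖v‖ < ρ)
    (hKv : K * ‖v‖ * 2 < ρ / 2) :
    b (y + v) ∈ ψ.source ∧ ‖ψ (b (y + v)) - ψ (b y)‖ ≤ K * ‖v‖ * 2 := by
  have hρ : 0 < ρ := (norm_nonneg v).trans_lt hv
  obtain ⟨hcont, hder⟩ := hb y v fun s => hUρ (add_sin_smul_mem_ball hv s)
  set u : ℝ → N := fun s => b (y + Real.sin s • v) with hu
  set z := ψ (b y)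
  have hpi : Real.pi / 2 ≤ 2 := by linarith [Real.pi_le_four]
  have hu0 : u 0 = b y := by simp [hu]
  have hu1 : u (Real.pi / 2) = b (y + v) := by simp [hu]
  let W : Set N := ψ.source ∩ ψ ⁻¹' ball z ρ
  have hW : IsOpen W := ψ.isOpen_inter_preimage isOpen_ball
  have hest : ∀ t, t ≤ Real.pi / 2 → (∀ s ∈ Icc 0 t, u s ∈ W) → 0 ≤ t →
      ‖ψ (u t) - z‖ ≤ K * ‖v‖ * 2 := by
    intro t ht hs ht0
    have h := norm_image_sub_le_of_norm_deriv_le_segment' (f := fun s => ψ (u s)) (a := 0) (b := t)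
      (fun s hs' => (hder s (hs s hs').1).hasDerivWithinAt) (C := K * ‖v‖) ?_ t ⟨ht0, le_rfl⟩
    · rw [hu0, sub_zero] at h
      exact h.trans (by gcongr; exact ht.trans hpi)
    · intro s hs'
      rw [norm_smul]
      have h1 : ‖Real.cos s‖ ≤ 1 := Real.abs_cos_le_one s
      refine (mul_le_of_le_one_left (norm_nonneg _) h1).trans ?_
      exact (Θ _).le_of_opNorm_le
        (hΘ _ (add_sin_smul_mem_ball hv s) _ (hs s ⟨hs'.1, hs'.2.le⟩).2) v
  have hall : ∀ t ∈ Icc 0 (Real.pi / 2), u t ∈ W := by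
    by_contra! hne
    obtain ⟨t₁, ht₁, ht₁W⟩ := hne
    -- The infimum of `T` is the first exit time; it belongs to `T` because `W` is open and the
    -- curve is continuous.
    let T : Set ℝ := Ici 0 ∩ u ⁻¹' Wᶜ
    have hT : IsClosed T := isClosed_Ici.inter (hW.isClosed_compl.preimage hcont)
    have hTbdd : BddBelow T := ⟨0, fun t ht => ht.1⟩
    have hT1 : t₁ ∈ T := ⟨ht₁.1, ht₁W⟩
    have hmem := hT.csInf_mem ⟨t₁, hT1⟩ hTbdd
    have hle : sInf T ≤ Real.pi / 2 := (csInf_le hTbdd hT1).trans ht₁.2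
    have hlt : ∀ s, 0 ≤ s → s < sInf T → u s ∈ W := by
      intro s hs0 hs
      by_contra hsW
      exact absurd (csInf_le hTbdd ⟨hs0, hsW⟩) (not_le.mpr hs)
    have hpos : 0 ≠ sInf T := by
      intro h0
      refine hmem.2 ?_
      rw [← h0, hu0]
      exact ⟨hy, mem_ball_self hρ⟩
    have hZt : closedBall z (ρ / 2) ⊆ ψ.target :=
      (closedBall_subset_ball (by linarith)).trans hψρ
    -- Compact in a Hausdorff space, hence closed: the curve lies in this set before the exit time,
    -- so also at it, although the set is contained in `W`.
    have hZ : IsClosed (ψ.symm '' closedBall z (ρ / 2)) :=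
      ((isCompact_closedBall z (ρ / 2)).image_of_continuousOn
        (ψ.continuousOn_symm.mono hZt)).isClosed
    have hsub : Ico 0 (sInf T) ⊆ u ⁻¹' (ψ.symm '' closedBall z (ρ / 2)) := by
      intro s hs
      have hsW := hlt s hs.1 hs.2
      refine ⟨ψ (u s), ?_, ψ.left_inv hsW.1⟩
      rw [mem_closedBall, dist_eq_norm]
      exact (hest s (hs.2.le.trans hle) (fun s' hs' => hlt s' hs'.1 (hs'.2.trans_lt hs.2))
        hs.1).trans hKv.le
    have hcl := (hZ.preimage hcont).closure_subset_iff.mpr hsub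
    rw [closure_Ico hpos] at hcl
    obtain ⟨w, hw, hwu⟩ := hcl (right_mem_Icc.mpr hmem.1)
    refine hmem.2 ?_
    rw [← hwu]
    refine ⟨ψ.map_target (hZt hw), ?_⟩
    rw [mem_preimage, ψ.right_inv (hZt hw)]
    exact closedBall_subset_ball (by linarith) hw
  rw [← hu1]
  exact ⟨(hall _ ⟨by positivity, le_rfl⟩).1, hest _ le_rfl hall (by positivity)⟩

theorem SolvesAlongCurves.continuousAt (hb : SolvesAlongCurves ψ Θ U b) (hU : IsOpen U)
    (hΘ : ContinuousOn Θ (U ×ˢ ψ.target)) {y : E} (hyU : y ∈ U) (hy : b y ∈ ψ.source) :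
    ContinuousAt b y := by
  have hopen : U ×ˢ ψ.target ∈ 𝓝 (y, ψ (b y)) :=
    (hU.prod ψ.open_target).mem_nhds ⟨hyU, ψ.map_source hy⟩
  have hc := hΘ.continuousAt hopen
  obtain ⟨ρ, hρ, h⟩ := Metric.mem_nhds_iff.mp
    (inter_mem hopen (hc.norm.eventually_lt_const (lt_add_one ‖Θ (y, ψ (b y))‖)))
  set K := ‖Θ (y, ψ (b y))‖ + 1
  have hK : 0 < K := by positivity
  rw [← ball_prod_same] at h
  -- The radius ρ / (4K) is what makes K‖v‖ · 2 < ρ/2.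
  have hbd : ∀ v : E, ‖v‖ < min ρ (ρ / (4 * K)) →
      b (y + v) ∈ ψ.source ∧ ‖ψ (b (y + v)) - ψ (b y)‖ ≤ K * ‖v‖ * 2 := by
    intro v hv
    rw [lt_min_iff, lt_div_iff₀ (by positivity)] at hv
    exact hb.bound hy hK.le (fun y' hy' => (h (show (y', _) ∈ _ from ⟨hy', mem_ball_self hρ⟩)).1.1)
      (fun z hz => (h (show (y, z) ∈ _ from ⟨mem_ball_self hρ, hz⟩)).1.2)
      (fun y' hy' z hz => le_of_lt (h ⟨hy', hz⟩).2) hv.1 (by linarith [hv.2])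
  have hnhds : ball (0 : E) (min ρ (ρ / (4 * K))) ∈ 𝓝 (0 : E) :=
    ball_mem_nhds _ (lt_min hρ (by positivity))
  have hψ : Tendsto (fun v => ψ (b (y + v))) (𝓝 0) (𝓝 (ψ (b y))) := by
    rw [tendsto_iff_norm_sub_tendsto_zero]
    refine squeeze_zero' (g := fun v : E => K * ‖v‖ * 2)
      (Eventually.of_forall fun _ => norm_nonneg _) ?_ ?_
    · filter_upwards [hnhds] with v hv
      exact (hbd v (mem_ball_zero_iff.mp hv)).2
    · have : Continuous fun v : E => K * ‖v‖ * 2 := by fun_prop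
      simpa using this.tendsto 0
  have h2 := (ψ.continuousAt_symm (ψ.map_source hy)).tendsto.comp hψ
  rw [ψ.left_inv hy] at h2
  have h3 : Tendsto (fun v => b (y + v)) (𝓝 0) (𝓝 (b y)) := by
    refine h2.congr' ?_
    filter_upwards [hnhds] with v hv
    exact ψ.left_inv (hbd v (mem_ball_zero_iff.mp hv)).1
  have h4 : Tendsto (fun y' => y' - y) (𝓝 y) (𝓝 0) := by
    have : Continuous fun y' : E => y' - y := by fun_prop
    simpa using this.tendsto y
  have h5 := h3.comp h4
  simp only [Function.comp_def, add_sub_cancel] at h5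
  exact h5

/-- By continuity, the points that `b` maps into the chart domain form an open set. There the
candidate derivative Θ(x, ψ(b x)) is continuous, hence is the derivative; it is as regular as ψ ∘ b
itself, so regularity improves by one order at each step. -/
theorem SolvesAlongCurves.contDiffAt (hb : SolvesAlongCurves ψ Θ U b) (hU : IsOpen U)
    (hΘ : ContDiffOn ℝ ∞ Θ (U ×ˢ ψ.target)) {y : E} (hyU : y ∈ U) (hy : b y ∈ ψ.source) :
    ContDiffAt ℝ ∞ (fun x => ψ (b x)) y := by
  have hcont := fun {y : E} (hyU : y ∈ U) (hy : b y ∈ ψ.source) =>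
    hb.continuousAt hU hΘ.continuousOn hyU hy
  let U₁ : Set E := {y | y ∈ U ∧ b y ∈ ψ.source}
  have hU₁ : IsOpen U₁ := by
    rw [isOpen_iff_mem_nhds]
    rintro x ⟨hx, hx'⟩
    exact inter_mem (hU.mem_nhds hx) (hcont hx hx' (ψ.open_source.mem_nhds hx'))
  have hmaps : MapsTo (fun x => (x, ψ (b x))) U₁ (U ×ˢ ψ.target) :=
    fun x hx => ⟨hx.1, ψ.map_source hx.2⟩
  have hf : ContinuousOn (fun x => ψ (b x)) U₁ := fun x hx =>
    ((ψ.continuousAt hx.2).comp (hcont hx.1 hx.2)).continuousWithinAt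
  have hL : ContinuousOn (fun x => Θ (x, ψ (b x))) U₁ :=
    hΘ.continuousOn.comp (continuousOn_id.prodMk hf) hmaps
  have hder : ∀ x ∈ U₁, HasFDerivAt (fun x => ψ (b x)) (Θ (x, ψ (b x))) x := by
    intro x hx
    obtain ⟨r, hr, hrU⟩ := Metric.mem_nhds_iff.mp (hU₁.mem_nhds hx)
    refine hasFDerivAt_of_sin_curves (L := fun x => Θ (x, ψ (b x))) hr
      (hL.continuousAt (hU₁.mem_nhds hx)) fun v hv t => ?_
    exact (hb x v fun s => (hrU (add_sin_smul_mem_ball hv s)).1).2 t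
      (hrU (add_sin_smul_mem_ball hv t)).2
  have hn : ∀ n : ℕ, ContDiffOn ℝ n (fun x => ψ (b x)) U₁ := by
    intro n
    induction n with
    | zero => exact contDiffOn_zero.mpr hf
    | succ n ih =>
      rw [Nat.cast_succ, contDiffOn_succ_iff_fderiv_of_isOpen hU₁]
      refine ⟨fun x hx => (hder x hx).differentiableAt.differentiableWithinAt, by simp, ?_⟩
      have h : ContDiffOn ℝ n (fun x => Θ (x, ψ (b x))) U₁ :=
        (hΘ.of_le (by exact_mod_cast le_top)).comp (contDiffOn_id.prodMk ih) hmaps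
      exact h.congr fun x hx => (hder x hx).fderiv
  exact (contDiffOn_infty.mpr hn).contDiffAt (hU₁.mem_nhds ⟨hyU, hy⟩)

end TotalDifferentialEquation

/-! ### Test curves in charts -/

section Charts

variable {E : Type*} [NormedAddCommGroup E] [NormedSpace ℝ E]
  {N : Type*} [TopologicalSpace N] [ChartedSpace E N] {c : ℝ → N} {t : ℝ} {v : E} {q : N}

theorem exists_smul_norm_lt (u : E) {ε : ℝ}
    (hε : 0 < ε) : ∃ c : ℝ, 0 < c ∧ ‖c • u‖ < ε := by
  refine ⟨ε / (‖u‖ + 1), by positivity, ?_⟩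
  rw [norm_smul, Real.norm_of_nonneg (by positivity), div_mul_eq_mul_div,
    div_lt_iff₀ (by positivity)]
  gcongr
  exact lt_add_one _

theorem HasVelocityAt.hasDerivAt_chartAt (hv : HasVelocityAt (E := E) c t v) (hq : c t = q) :
    HasDerivAt (fun s => chartAt E q (c s)) v t := by
  subst hq
  exact hv.hasDerivAt_chart

theorem HasVelocityAt.eventually_mem_source (hv : HasVelocityAt (E := E) c t v) (hq : c t = q) :
    ∀ᶠ s in nhds t, c s ∈ (chartAt E q).source := by
  subst hq
  exact hv.1.eventually_mem ((chartAt E (c t)).open_source.mem_nhds (mem_chart_source E (c t)))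

theorem hasVelocityAt_of_hasDerivAt {l : ℝ → E} (hl : HasDerivAt l v t) :
    HasVelocityAt (E := E) l t v :=
  hasVelocityAt_of_hasMFDerivAt hl.hasFDerivAt.hasMFDerivAt
    (ContinuousLinearMap.toSpanSingleton_apply_one (R₁ := ℝ) (M₁ := E) _)

variable [IsManifold 𝓘(ℝ, E) ∞ N]

/-- The curve `s ↦ y + sin s • v` in the chart around `p`. -/
noncomputable def sinCurve (p : N) (y v : E) (s : ℝ) : N :=
  (extChartAt 𝓘(ℝ, E) p).symm (y + Real.sin s • v)

variable {p : N} {y : E}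

theorem contMDiff_sinCurve (h : ∀ s : ℝ, y + Real.sin s • v ∈ (extChartAt 𝓘(ℝ, E) p).target) :
    ContMDiff 𝓘(ℝ, ℝ) 𝓘(ℝ, E) ∞ (sinCurve p y v) := by
  have hl : ContMDiff 𝓘(ℝ, ℝ) 𝓘(ℝ, E) ∞ (fun s : ℝ => y + Real.sin s • v) :=
    (contDiff_const.add (Real.contDiff_sin.smul contDiff_const)).contMDiff
  exact (contMDiffOn_extChartAt_symm p).comp_contMDiff hl h

theorem hasVelocityAt_sinCurve
    (h : ∀ s : ℝ, y + Real.sin s • v ∈ (extChartAt 𝓘(ℝ, E) p).target) (t : ℝ) :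
    HasVelocityAt (E := E) (sinCurve p y v) t
      (chartInvDeriv p (y + Real.sin t • v) (Real.cos t • v)) := by
  have hl : HasDerivAt (fun s : ℝ => y + Real.sin s • v) (Real.cos t • v) t :=
    ((Real.hasDerivAt_sin t).smul_const v).const_add y
  refine (hasVelocityAt_of_hasDerivAt hl).comp (f := (extChartAt 𝓘(ℝ, E) p).symm) ?_
  exact ((contMDiffOn_extChartAt_symm (n := ∞) p).contMDiffAt
    ((isOpen_extChartAt_target p).mem_nhds (h t))).mdifferentiableAt (by simp)

/-- The tangent space at `p` is identified with `E` by the preferred chart at `p`, in which the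
curve is y + sin s • v. Uniqueness of the derivative in this chart then removes `chartInvDeriv`. -/
theorem hasVelocityAt_sinCurve_zero
    (h : ∀ s : ℝ, extChartAt 𝓘(ℝ, E) p p + Real.sin s • v ∈ (extChartAt 𝓘(ℝ, E) p).target) :
    HasVelocityAt (E := E) (sinCurve p (extChartAt 𝓘(ℝ, E) p p) v) 0 v := by
  have hK := hasVelocityAt_sinCurve h 0
  have h0 : sinCurve p (extChartAt 𝓘(ℝ, E) p p) v 0 = p := by simp [sinCurve]
  have h1 := hK.hasDerivAt_chartAt h0
  have h2 : HasDerivAt (fun s : ℝ => extChartAt 𝓘(ℝ, E) p p + Real.sin s • v)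
      (Real.cos 0 • v) 0 := ((Real.hasDerivAt_sin 0).smul_const v).const_add _
  rw [Real.cos_zero, one_smul] at h2
  have e : (fun s => chartAt E p (sinCurve p (extChartAt 𝓘(ℝ, E) p p) v s)) =
      fun s : ℝ => extChartAt 𝓘(ℝ, E) p p + Real.sin s • v := by
    funext s
    exact (extChartAt 𝓘(ℝ, E) p).right_inv (h s)
  rw [e] at h1
  exact (congrArg (HasVelocityAt (E := E) _ 0) (h1.unique h2)).mp hK

end Charts

/-! ### Smooth coefficients of the differential equation -/

section Coefficients

variable {EG : Type*} [NormedAddCommGroup EG] [NormedSpace ℝ EG]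
  {G : Type*} [TopologicalSpace G] [ChartedSpace EG G] [Group G]
  {EH : Type*} [NormedAddCommGroup EH] [NormedSpace ℝ EH]
  {H : Type*} [TopologicalSpace H] [ChartedSpace EH H] [Group H]
  (C : SmoothCrossedModule EG G EH H)

namespace SmoothCrossedModule

/-- The map `(g, x, y) ↦ α(g, x k y)` in charts, where `k` has coordinates `z` in the chart
around `k₀`. -/
def sandwich (k₀ : H) (z : EH) (w : EG × EH × EH) : EH :=
  chartAt EH k₀ (C.α ((chartAt EG (1 : G)).symm w.1)
    ((chartAt EH (1 : H)).symm w.2.1 *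
      ((chartAt EH k₀).symm z * (chartAt EH (1 : H)).symm w.2.2)))

/-- The coordinates of `(1, 1, 1)`. -/
def unitCoord (G H : Type*) [TopologicalSpace G] [ChartedSpace EG G] [Group G]
    [TopologicalSpace H] [ChartedSpace EH H] [Group H] : EG × EH × EH :=
  (chartAt EG (1 : G) 1, chartAt EH (1 : H) 1, chartAt EH (1 : H) 1)

/-- The derivative at `(1, 1, 1)` of `(g, x, y) ↦ α(g, x k y)` in charts. -/
noncomputable def sandwichDeriv (k₀ : H) (z : EH) : EG × EH × EH →L[ℝ] EH :=
  fderiv ℝ (C.sandwich k₀ z) (unitCoord G H)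

variable [LieGroup 𝓘(ℝ, EG) ∞ G] [LieGroup 𝓘(ℝ, EH) ∞ H]

/-- Joint smoothness in the base point and the increments is what makes the derivative in the
increments depend smoothly on the base point. -/
theorem contDiffAt_sandwich (k₀ : H) {z : EH} (hz : z ∈ (chartAt EH k₀).target) :
    ContDiffAt ℝ ∞ (Function.uncurry (C.sandwich k₀)) (z, unitCoord G H) := by
  rw [← contMDiffAt_iff_contDiffAt]
  have hsymm : ∀ (k : H) {z : EH}, z ∈ (chartAt EH k).target →
      ContMDiffAt 𝓘(ℝ, EH) 𝓘(ℝ, EH) ∞ (chartAt EH k).symm z := fun k z hz =>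
    contMDiffOn_chart_symm.contMDiffAt ((chartAt EH k).open_target.mem_nhds hz)
  have hsymmG : ContMDiffAt 𝓘(ℝ, EG) 𝓘(ℝ, EG) ∞ (chartAt EG (1 : G)).symm
      (chartAt EG (1 : G) 1) :=
    contMDiffOn_chart_symm.contMDiffAt
      ((chartAt EG (1 : G)).open_target.mem_nhds (mem_chart_target _ _))
  have h1 : ContMDiffAt 𝓘(ℝ, EH × EG × EH × EH) 𝓘(ℝ, EG) ∞
      (fun q : EH × EG × EH × EH => (chartAt EG (1 : G)).symm q.2.1) (z, unitCoord G H) :=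
    hsymmG.comp (x := ((z, unitCoord G H) : EH × EG × EH × EH))
      (f := fun q : EH × EG × EH × EH => q.2.1) (contDiff_snd.fst.contMDiff _)
  have h2 : ContMDiffAt 𝓘(ℝ, EH × EG × EH × EH) 𝓘(ℝ, EH) ∞
      (fun q : EH × EG × EH × EH => (chartAt EH (1 : H)).symm q.2.2.1) (z, unitCoord G H) :=
    (hsymm 1 (mem_chart_target _ _)).comp (x := ((z, unitCoord G H) : EH × EG × EH × EH))
      (f := fun q : EH × EG × EH × EH => q.2.2.1) (contDiff_snd.snd.fst.contMDiff _)
  have h3 : ContMDiffAt 𝓘(ℝ, EH × EG × EH × EH) 𝓘(ℝ, EH) ∞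
      (fun q : EH × EG × EH × EH => (chartAt EH (1 : H)).symm q.2.2.2) (z, unitCoord G H) :=
    (hsymm 1 (mem_chart_target _ _)).comp (x := ((z, unitCoord G H) : EH × EG × EH × EH))
      (f := fun q : EH × EG × EH × EH => q.2.2.2) (contDiff_snd.snd.snd.contMDiff _)
  have h4 : ContMDiffAt 𝓘(ℝ, EH × EG × EH × EH) 𝓘(ℝ, EH) ∞
      (fun q : EH × EG × EH × EH => (chartAt EH k₀).symm q.1) (z, unitCoord G H) :=
    (hsymm k₀ hz).comp (x := ((z, unitCoord G H) : EH × EG × EH × EH))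
      (f := fun q : EH × EG × EH × EH => q.1) (contDiff_fst.contMDiff _)
  have h5 := (C.smooth_α.contMDiffAt).comp (z, unitCoord G H) (h1.prodMk (h2.mul (h4.mul h3)))
  refine ContMDiffAt.comp (x := ((z, unitCoord G H) : EH × EG × EH × EH))
    (g := chartAt EH k₀) (I' := 𝓘(ℝ, EH)) ?_ h5
  refine (contMDiffOn_chart (I := 𝓘(ℝ, EH))).contMDiffAt
    ((chartAt EH k₀).open_source.mem_nhds ?_)
  simp only [unitCoord, (chartAt EG (1 : G)).left_inv (mem_chart_source _ _),
    (chartAt EH (1 : H)).left_inv (mem_chart_source _ _), map_one, one_mul, mul_one,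
    MulAut.one_apply]
  exact (chartAt EH k₀).map_target hz

theorem contDiffOn_sandwichDeriv (k₀ : H) :
    ContDiffOn ℝ ∞ (C.sandwichDeriv k₀) (chartAt EH k₀).target := fun z hz =>
  (ContDiffAt.fderiv (f := C.sandwich k₀) (g := fun _ => unitCoord G H) (n := ∞)
    (C.contDiffAt_sandwich k₀ hz) contDiffAt_const (by norm_cast)).contDiffWithinAt

theorem hasDerivAt_sandwich {k₀ k : H} (hk : k ∈ (chartAt EH k₀).source) {g : ℝ → G}
    {x y : ℝ → H} {Z : EG} {X Y : EH} (hg0 : g 0 = 1) (hx0 : x 0 = 1) (hy0 : y 0 = 1)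
    (hg : HasVelocityAt (E := EG) g 0 Z) (hx : HasVelocityAt (E := EH) x 0 X)
    (hy : HasVelocityAt (E := EH) y 0 Y) :
    HasDerivAt (fun t => chartAt EH k₀ (C.α (g t) (x t * (k * y t))))
      (C.sandwichDeriv k₀ (chartAt EH k₀ k) (Z, X, Y)) 0 := by
  have hw : HasDerivAt (fun t => (chartAt EG (1 : G) (g t), chartAt EH (1 : H) (x t),
      chartAt EH (1 : H) (y t))) (Z, X, Y) 0 :=
    (hg.hasDerivAt_chartAt hg0).prodMk
      ((hx.hasDerivAt_chartAt hx0).prodMk (hy.hasDerivAt_chartAt hy0))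
  have hd : DifferentiableAt ℝ (C.sandwich k₀ (chartAt EH k₀ k)) (unitCoord G H) := by
    have h := (C.contDiffAt_sandwich k₀ ((chartAt EH k₀).map_source hk)).differentiableAt (by simp)
    exact h.comp (unitCoord G H) (f := fun w => (chartAt EH k₀ k, w))
      ((differentiableAt_const _).prodMk differentiableAt_id)
  have h := HasFDerivAt.comp_hasDerivAt_of_eq 0 hd.hasFDerivAt hw
    (by rw [hg0, hx0, hy0]; rfl)
  -- Charts and their inverses cancel only while the curves stay in the chart domains, that is, for
  -- times near 0.
  refine h.congr_of_eventuallyEq ?_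
  filter_upwards [hg.eventually_mem_source hg0, hx.eventually_mem_source hx0,
    hy.eventually_mem_source hy0] with t h1 h2 h3
  simp only [Function.comp, sandwich, (chartAt EG (1 : G)).left_inv h1,
    (chartAt EH (1 : H)).left_inv h2, (chartAt EH (1 : H)).left_inv h3,
    (chartAt EH k₀).left_inv hk]

end SmoothCrossedModule

end Coefficients

/-! ### Smoothness of a modification and the equation for φ' -/

section Smoothness

variable {EG : Type*} [NormedAddCommGroup EG] [NormedSpace ℝ EG]
  {G : Type*} [TopologicalSpace G] [ChartedSpace EG G] [Group G] [LieGroup 𝓘(ℝ, EG) ∞ G]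
  {EH : Type*} [NormedAddCommGroup EH] [NormedSpace ℝ EH]
  {H : Type*} [TopologicalSpace H] [ChartedSpace EH H] [Group H] [LieGroup 𝓘(ℝ, EH) ∞ H]
  {C : SmoothCrossedModule EG G EH H}
  {EM : Type*} [NormedAddCommGroup EM] [NormedSpace ℝ EM]
  {M : Type*} [TopologicalSpace M] [ChartedSpace EM M]
  {P₀ : Type*} [TopologicalSpace P₀] [ChartedSpace (EM × EG) P₀]
  {P₁ : Type*} [TopologicalSpace P₁] [ChartedSpace (EM × EG × EH) P₁]
  {P₀' : Type*} [TopologicalSpace P₀'] [ChartedSpace (EM × EG) P₀']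
  {P₁' : Type*} [TopologicalSpace P₁'] [ChartedSpace (EM × EG × EH) P₁']
  {P : PrincipalTwoBundle C EM M P₀ P₁} {P' : PrincipalTwoBundle C EM M P₀' P₁'}
  {D : TwoConnection P} {D' : TwoConnection P'}

/-- The right-hand side of the total differential equation satisfied by a 2-morphism, in the
charts around `p₀` and `k₀`. -/
noncomputable def twoHomField (f f' : BundleHom D D') (p₀ : P₀) (k₀ : H) (q : (EM × EG) × EH) :
    EM × EG →L[ℝ] EH :=
  (C.sandwichDeriv k₀ q.2).comp ((-localOneForm D.A p₀ q.1).prod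
    ((-localOneForm f'.φ p₀ q.1).prod (localOneForm f.φ p₀ q.1)))

theorem contDiffOn_twoHomField (f f' : BundleHom D D') (p₀ : P₀) (k₀ : H) :
    ContDiffOn ℝ ∞ (twoHomField f f' p₀ k₀)
      ((extChartAt 𝓘(ℝ, EM × EG) p₀).target ×ˢ (chartAt EH k₀).target) := by
  have hfst : Set.MapsTo (Prod.fst : (EM × EG) × EH → EM × EG)
      ((extChartAt 𝓘(ℝ, EM × EG) p₀).target ×ˢ (chartAt EH k₀).target)
      (extChartAt 𝓘(ℝ, EM × EG) p₀).target := fun _ h => h.1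
  have h1 := (D.smooth_A p₀).comp contDiffOn_fst hfst
  have h2 := (f.smooth_φ p₀).comp contDiffOn_fst hfst
  have h3 := (f'.smooth_φ p₀).comp contDiffOn_fst hfst
  have h4 : ContDiffOn ℝ ∞ (fun q : (EM × EG) × EH => C.sandwichDeriv k₀ q.2)
      ((extChartAt 𝓘(ℝ, EM × EG) p₀).target ×ˢ (chartAt EH k₀).target) :=
    (C.contDiffOn_sandwichDeriv k₀).comp contDiffOn_snd fun _ h => h.2
  have h5 := (ContinuousLinearMap.prodₗᵢ (𝕜 := ℝ) (E := EM × EG) (F := EH) (G := EH) ℝ).contDiff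
    (n := ∞) |>.comp_contDiffOn (h3.neg.prodMk h2)
  have h6 := (ContinuousLinearMap.prodₗᵢ (𝕜 := ℝ) (E := EM × EG) (F := EG) (G := EH × EH)
    ℝ).contDiff (n := ∞) |>.comp_contDiffOn (h1.neg.prodMk h5)
  exact h4.clm_comp h6

variable {𝓕 𝓖 : TransportTwoFunctor C EM M}
  {r : Realization 𝓕 D} {r' : Realization 𝓖 D'}
  {ρ ρ' : PseudoNat 𝓕 𝓖} {f f' : BundleHom D D'}
  {𝓐 : ∀ x, TwoTorsor.TwoHom (ρ.app x) (ρ'.app x)}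

/-- Having a velocity implies continuity; the formula at time 0 is applied to every translate K(t +
·). -/
theorem IsModification.continuous_comp (hρ : ρ.Corresponds r r' f) (hρ' : ρ'.Corresponds r r' f')
    (h𝓐 : IsModification ρ ρ' 𝓐) {K : ℝ → P₀}
    (hK : ContMDiff 𝓘(ℝ, ℝ) 𝓘(ℝ, EM × EG) ∞ K) :
    Continuous (fun t => (hMap r 𝓐 (K t))⁻¹) := by
  rw [continuous_iff_continuousAt]
  intro t
  have hKt : ContMDiff 𝓘(ℝ, ℝ) 𝓘(ℝ, EM × EG) ∞ (fun s => K (t + s)) :=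
    hK.comp (contDiff_const.add contDiff_id).contMDiff
  have h := (h𝓐.hasVelocityAt_mul_inv hρ hρ' hKt (a := fun p => (hMap r 𝓐 p)⁻¹)
    fun _ => rfl).mul_const (hMap r 𝓐 (K (t + 0)))⁻¹
  have e : (fun s => (hMap r 𝓐 (K (t + s)))⁻¹ * (hMap r 𝓐 (K (t + 0)))⁻¹⁻¹ *
      (hMap r 𝓐 (K (t + 0)))⁻¹) = fun s => (hMap r 𝓐 (K (t + s)))⁻¹ := by
    funext s; exact inv_mul_cancel_right _ _
  rw [e] at h
  exact (HasVelocityAt.comp_add h).1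

theorem IsModification.hasDerivAt_chart_zero (hρ : ρ.Corresponds r r' f)
    (hρ' : ρ'.Corresponds r r' f') (h𝓐 : IsModification ρ ρ' 𝓐) {K : ℝ → P₀}
    (hK : ContMDiff 𝓘(ℝ, ℝ) 𝓘(ℝ, EM × EG) ∞ K) {k₀ : H} {q : P₀} (hq : K 0 = q) {V : EM × EG}
    (hV : HasVelocityAt (E := EM × EG) K 0 V)
    (h0 : (hMap r 𝓐 q)⁻¹ ∈ (chartAt EH k₀).source) :
    HasDerivAt (fun s => chartAt EH k₀ (hMap r 𝓐 (K s))⁻¹)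
      (C.sandwichDeriv k₀ (chartAt EH k₀ (hMap r 𝓐 q)⁻¹)
        (-(D.A q V), -(f'.φ q V), f.φ q V)) 0 := by
  subst hq
  obtain ⟨g, x, y, hg0, hx0, hy0, hg, hx, hy, h⟩ := h𝓐.exists_curves hρ hρ' hK
  rw [hV.velocity_eq] at hg hx hy
  have hd := C.hasDerivAt_sandwich h0 hg0 hx0 hy0 hg hx hy
  simp only [← h] at hd
  exact hd

theorem IsModification.hasDerivAt_chart (hρ : ρ.Corresponds r r' f)
    (hρ' : ρ'.Corresponds r r' f') (h𝓐 : IsModification ρ ρ' 𝓐) {K : ℝ → P₀}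
    (hK : ContMDiff 𝓘(ℝ, ℝ) 𝓘(ℝ, EM × EG) ∞ K) {k₀ : H} {t : ℝ} {V : EM × EG}
    (hV : HasVelocityAt (E := EM × EG) K t V)
    (ht : (hMap r 𝓐 (K t))⁻¹ ∈ (chartAt EH k₀).source) :
    HasDerivAt (fun s => chartAt EH k₀ (hMap r 𝓐 (K s))⁻¹)
      (C.sandwichDeriv k₀ (chartAt EH k₀ (hMap r 𝓐 (K t))⁻¹)
        (-(D.A (K t) V), -(f'.φ (K t) V), f.φ (K t) V)) t := by
  have hKt : ContMDiff 𝓘(ℝ, ℝ) 𝓘(ℝ, EM × EG) ∞ (fun s => K (t + s)) :=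
    hK.comp (contDiff_const.add contDiff_id).contMDiff
  have hVt : HasVelocityAt (E := EM × EG) (fun s => K (t + s)) 0 V := by
    have h := hasVelocityAt_velocity (hKt.mdifferentiable (by simp) 0)
    exact (congrArg (HasVelocityAt (E := EM × EG) _ 0) (h.comp_add.unique hV)).mp h
  have hd := h𝓐.hasDerivAt_chart_zero hρ hρ' hKt (congrArg K (add_zero t)) hVt ht
  have hd' := HasDerivAt.comp_sub_const t t (by rw [sub_self]; exact hd)
  simp only [add_sub_cancel] at hd'
  exact hd'

variable [IsManifold 𝓘(ℝ, EM × EG) ∞ P₀]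

theorem IsModification.solvesAlongCurves (hρ : ρ.Corresponds r r' f)
    (hρ' : ρ'.Corresponds r r' f') (h𝓐 : IsModification ρ ρ' 𝓐) (p₀ : P₀) (k₀ : H) :
    SolvesAlongCurves (chartAt EH k₀) (twoHomField f f' p₀ k₀)
      (extChartAt 𝓘(ℝ, EM × EG) p₀).target
      (fun y => (hMap r 𝓐 ((extChartAt 𝓘(ℝ, EM × EG) p₀).symm y))⁻¹) := by
  intro y v hyv
  have hK := contMDiff_sinCurve hyv
  refine ⟨h𝓐.continuous_comp hρ hρ' hK, fun t ht => ?_⟩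
  have h := h𝓐.hasDerivAt_chart hρ hρ' hK (hasVelocityAt_sinCurve hyv t) ht
  -- The velocity of the test curve carries the factor cos t, absorbed by linearity of the field.
  rw [← map_smul]
  exact h

theorem IsModification.contMDiff [FiniteDimensional ℝ EH] [T2Space H] (hρ : ρ.Corresponds r r' f)
    (hρ' : ρ'.Corresponds r r' f') (h𝓐 : IsModification ρ ρ' 𝓐) :
    ContMDiff 𝓘(ℝ, EM × EG) 𝓘(ℝ, EH) ∞ (fun p => (hMap r 𝓐 p)⁻¹) := by
  intro p₀
  set a : P₀ → H := fun p => (hMap r 𝓐 p)⁻¹ with ha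
  have hs := h𝓐.solvesAlongCurves hρ hρ' p₀ (a p₀)
  have hU := isOpen_extChartAt_target (I := 𝓘(ℝ, EM × EG)) p₀
  have hΘ := contDiffOn_twoHomField f f' p₀ (a p₀)
  have hmem : a ((extChartAt 𝓘(ℝ, EM × EG) p₀).symm (extChartAt 𝓘(ℝ, EM × EG) p₀ p₀)) ∈
      (chartAt EH (a p₀)).source := by
    rw [extChartAt_to_inv]
    exact mem_chart_source _ _
  have h1 := hs.continuousAt hU hΘ.continuousOn (mem_extChartAt_target p₀) hmem
  have h2 := hs.contDiffAt hU hΘ (mem_extChartAt_target p₀) hmem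
  rw [contMDiffAt_iff]
  refine ⟨?_, h2.contDiffWithinAt⟩
  have h3 : ContinuousAt (fun p => a ((extChartAt 𝓘(ℝ, EM × EG) p₀).symm
      (extChartAt 𝓘(ℝ, EM × EG) p₀ p))) p₀ :=
    ContinuousAt.comp (f := extChartAt 𝓘(ℝ, EM × EG) p₀) h1 (continuousAt_extChartAt p₀)
  refine h3.congr ?_
  filter_upwards [extChartAt_source_mem_nhds (I := 𝓘(ℝ, EM × EG)) p₀] with p hp
  rw [(extChartAt 𝓘(ℝ, EM × EG) p₀).left_inv hp]

/-- The velocity of a(K) a(p)⁻¹ is computed twice, by the chain rule and by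
`IsModification.hasVelocityAt_mul_inv`. -/
theorem IsModification.φ_eq (hρ : ρ.Corresponds r r' f) (hρ' : ρ'.Corresponds r r' f')
    (h𝓐 : IsModification ρ ρ' 𝓐) {a : P₀ → H} (ha : ∀ p, a p = (hMap r 𝓐 p)⁻¹)
    (has : ContMDiff 𝓘(ℝ, EM × EG) 𝓘(ℝ, EH) ∞ a) (p : P₀)
    (v : TangentSpace 𝓘(ℝ, EM × EG) p) :
    f'.φ p v = Ad (a p) (f.φ p v) - C.αOrbit (a p) (D.A p v) -
      rightTrivialize (a p) (mfderiv 𝓘(ℝ, EM × EG) 𝓘(ℝ, EH) a p v) := by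
  have hcurve : ∀ {K : ℝ → P₀}, ContMDiff 𝓘(ℝ, ℝ) 𝓘(ℝ, EM × EG) ∞ K → ∀ V : EM × EG,
      HasVelocityAt (E := EM × EG) K 0 V → K 0 = p →
      (rightTrivialize (EG := EH) (a p) (mfderiv 𝓘(ℝ, EM × EG) 𝓘(ℝ, EH) a p V) : EH) =
        Ad (EG := EH) (a p) (f.φ p V) - C.αOrbit (a p) (D.A p V) - f'.φ p V := by
    intro K hK V hV hp
    subst hp
    have h1 := h𝓐.hasVelocityAt_mul_inv hρ hρ' hK ha
    rw [hV.velocity_eq] at h1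
    have h2 := (hV.comp (has.mdifferentiable (by simp) (K 0))).rightTrivialize
    exact h2.unique h1
  let R : EM × EG →L[ℝ] EH :=
    (rightTrivialize (EG := EH) (a p)).comp (mfderiv 𝓘(ℝ, EM × EG) 𝓘(ℝ, EH) a p)
  let S : EM × EG →L[ℝ] EH :=
    (Ad (EG := EH) (a p)).comp (f.φ p) - (C.αOrbit (a p)).comp (D.A p) - f'.φ p
  have hRS : ∀ u : EM × EG, R u = S u := by
    intro u
    obtain ⟨ε, hε, hball⟩ := Metric.mem_nhds_iff.mp
      (extChartAt_target_mem_nhds (I := 𝓘(ℝ, EM × EG)) p)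
    -- Only short vectors have test curves that stay in the chart; both sides are linear, so a
    -- positive multiple of `u` suffices.
    obtain ⟨c, hc, hcu⟩ := exists_smul_norm_lt u hε
    have hK := fun s => hball (add_sin_smul_mem_ball hcu s)
    have h : R (c • u) = S (c • u) := hcurve (contMDiff_sinCurve hK) _
      (hasVelocityAt_sinCurve_zero hK) (by simp [sinCurve])
    rw [map_smul, map_smul] at h
    exact smul_right_injective EH hc.ne' h
  have halg : ∀ X Y Z W : EH, X = Y - Z - W → W = Y - Z - X := by
    rintro X Y Z W rfl
    abel
  exact halg _ _ _ _ (hRS v)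

end Smoothness

/-! ### The equivalence and the bijection -/

section Main

variable {EG : Type*} [NormedAddCommGroup EG] [NormedSpace ℝ EG]
  {G : Type*} [TopologicalSpace G] [ChartedSpace EG G] [Group G] [LieGroup 𝓘(ℝ, EG) ∞ G]
  {EH : Type*} [NormedAddCommGroup EH] [NormedSpace ℝ EH] [FiniteDimensional ℝ EH]
  {H : Type*} [TopologicalSpace H] [ChartedSpace EH H] [Group H] [LieGroup 𝓘(ℝ, EH) ∞ H]
  [T2Space H]
  {C : SmoothCrossedModule EG G EH H}
  {EM : Type*} [NormedAddCommGroup EM] [NormedSpace ℝ EM]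
  {M : Type*} [TopologicalSpace M] [ChartedSpace EM M]
  {P₀ : Type*} [TopologicalSpace P₀] [ChartedSpace (EM × EG) P₀]
  [IsManifold 𝓘(ℝ, EM × EG) ∞ P₀]
  {P₁ : Type*} [TopologicalSpace P₁] [ChartedSpace (EM × EG × EH) P₁]
  {P₀' : Type*} [TopologicalSpace P₀'] [ChartedSpace (EM × EG) P₀']
  {P₁' : Type*} [TopologicalSpace P₁'] [ChartedSpace (EM × EG × EH) P₁']
  {P : PrincipalTwoBundle C EM M P₀ P₁} {P' : PrincipalTwoBundle C EM M P₀' P₁'}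
  {D : TwoConnection P} {D' : TwoConnection P'}
  {𝓕 𝓖 : TransportTwoFunctor C EM M}
  {r : Realization 𝓕 D} {r' : Realization 𝓖 D'}
  {ρ ρ' : PseudoNat 𝓕 𝓖} {f f' : BundleHom D D'}

theorem isModification_iff_isBundleTwoHom (hρ : ρ.Corresponds r r' f)
    (hρ' : ρ'.Corresponds r r' f') (𝓐 : ∀ x, TwoTorsor.TwoHom (ρ.app x) (ρ'.app x)) :
    IsModification ρ ρ' 𝓐 ↔ IsBundleTwoHom f f' (fun p => (hMap r 𝓐 p)⁻¹) := by
  refine ⟨fun h => ?_, fun h => ?_⟩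
  · have hs := h.contMDiff hρ hρ'
    refine ⟨hs, fun p g => ?_, fun p => ?_, h.φ_eq hρ hρ' (fun _ => rfl) hs⟩
    · rw [hMap_act, ← map_inv]
    · rw [← hMap_obj 𝓐 hρ hρ' p, P'.act₀_mul, map_inv, mul_inv_cancel, P'.act₀_one]
  -- Completeness enters through uniqueness of integral curves.
  · have := FiniteDimensional.complete ℝ EH
    exact fun {x y} => h.isModification hρ hρ' (x := x) (y := y)

end Main

end TwoTransport

theorem mainTheorem8
    {EG : Type*} [NormedAddCommGroup EG] [NormedSpace ℝ EG] [FiniteDimensional ℝ EG]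
    {G : Type*} [TopologicalSpace G] [ChartedSpace EG G] [Group G] [LieGroup 𝓘(ℝ, EG) ∞ G]
    [T2Space G]
    {EH : Type*} [NormedAddCommGroup EH] [NormedSpace ℝ EH] [FiniteDimensional ℝ EH]
    {H : Type*} [TopologicalSpace H] [ChartedSpace EH H] [Group H] [LieGroup 𝓘(ℝ, EH) ∞ H]
    [T2Space H]
    (C : SmoothCrossedModule EG G EH H)
    {EM : Type*} [NormedAddCommGroup EM] [NormedSpace ℝ EM] [FiniteDimensional ℝ EM]
    {M : Type*} [TopologicalSpace M] [ChartedSpace EM M] [IsManifold 𝓘(ℝ, EM) ∞ M]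
    [T2Space M] [SigmaCompactSpace M]
    {P₀ : Type*} [TopologicalSpace P₀] [ChartedSpace (EM × EG) P₀]
    [IsManifold 𝓘(ℝ, EM × EG) ∞ P₀] [T2Space P₀]
    {P₁ : Type*} [TopologicalSpace P₁] [ChartedSpace (EM × EG × EH) P₁]
    [IsManifold 𝓘(ℝ, EM × EG × EH) ∞ P₁] [T2Space P₁]
    {P₀' : Type*} [TopologicalSpace P₀'] [ChartedSpace (EM × EG) P₀']
    [IsManifold 𝓘(ℝ, EM × EG) ∞ P₀'] [T2Space P₀']
    {P₁' : Type*} [TopologicalSpace P₁'] [ChartedSpace (EM × EG × EH) P₁']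
    [IsManifold 𝓘(ℝ, EM × EG × EH) ∞ P₁'] [T2Space P₁']
    {P : PrincipalTwoBundle C EM M P₀ P₁} {P' : PrincipalTwoBundle C EM M P₀' P₁'}
    (D : TwoConnection P) (D' : TwoConnection P')
    (𝓕 𝓖 : TransportTwoFunctor C EM M)
    (r : Realization 𝓕 D) (r' : Realization 𝓖 D')
    (ρ ρ' : PseudoNat 𝓕 𝓖) (f f' : BundleHom D D')
    (hρ : ρ.Corresponds r r' f) (hρ' : ρ'.Corresponds r r' f') :
    (∀ 𝓐 : ∀ x, TwoTorsor.TwoHom (ρ.app x) (ρ'.app x),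
      IsModification ρ ρ' 𝓐 ↔ IsBundleTwoHom f f' (fun p => (hMap r 𝓐 p)⁻¹)) ∧
    Set.BijOn
      (fun (𝓐 : ∀ x, TwoTorsor.TwoHom (ρ.app x) (ρ'.app x)) (p : P₀) => (hMap r 𝓐 p)⁻¹)
      {𝓐 | IsModification ρ ρ' 𝓐} {a | IsBundleTwoHom f f' a} := by
  have hiff := isModification_iff_isBundleTwoHom hρ hρ'
  refine ⟨hiff, fun 𝓐 h => (hiff 𝓐).mp h, fun 𝓐 _ 𝓐' _ h => ?_, fun a ha => ?_⟩
  · exact hMap_injective r fun p => inv_injective (congrFun h p)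
  -- Equivariance and the target equation already produce the family; that it is a modification
  -- follows from the equivalence, since its map is `a`.
  · have e := funext (hMap_twoHomOfMap hρ hρ' ha.equivariant ha.obj_eq)
    refine ⟨twoHomOfMap hρ hρ' ha.equivariant ha.obj_eq, (hiff _).mpr ?_, e⟩
    rw [e]
    exact ha
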